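/- An oriented link in $\mathbb{R}^3$ is a finite disjoint union of smoothly embedded oriented circles. Two oriented links are \emph{oriented isotopic} if there is a smooth ambient isotopy of $\mathbb{R}^3$, starting at the identity, whose final map carries the first link onto the second and preserves the orientations of all components; the components may be interchanged. Let $p,q$ be coprime integers with $q$ even and $|p/q|<1$. Then $p/q$ has a unique continued fraction expansion $$\frac pq=[b_1,\dots,b_n]=\cfrac{1}{b_1+\cfrac{1}{b_2+\cfrac{1}{\dots+\cfrac{1}{b_n}}}}$$ with all $b_i$ nonzero even integers, and $n$ is odd. Take four horizontal strands, numbered from top to bottom, and form on them, from left to right, the braid word $A^{b_1}B^{b_2}A^{b_3}\cdots A^{b_n}$, where $A$ is a right-handed half-twist of the second and third strands and $B$ is a left-handed half-twist of the first and second strands. Close the braid by joining, at the left end as well as at the right end, the first strand to the second and the third to the fourth. The result is a two-component link diagram. Its two leftmost arcs belong to different components; orient both components so that these two arcs are directed downwards. The oriented link with this diagram is denoted by $L^+(p/q)$. Let $p,\bar p,q$ be integers with $q$ even, $p$ and $\bar p$ coprime to $q$, $|p/q|<1$ and $|\bar p/q|<1$. If $p\,\bar p\equiv 1 \pmod{2q}$,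 then the oriented links $L^+(p/q)$ and $L^+(\bar p/q)$ are oriented isotopic. -/

import Mathlib

open scoped ContDiff

noncomputable section

/-- Euclidean three-space. Diagrams are drawn in the `(x 0, x 1)`-plane, with `x 0` pointing to the
right and `x 1` upwards, and are looked at from the side `x 2 > 0`. -/
abbrev Space : Type := EuclideanSpace ℝ (Fin 3)

/-- An oriented smooth link in three-space with `k` components, numbered by `Fin k`. Each component
is given by a smooth `2π`-periodic regular parametrization, and is oriented by it. -/
structure OrientedLink (k : ℕ) where
  curve : Fin k → ℝ → Space
  smooth : ∀ i, ContDiff ℝ ∞ (curve i)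
  periodic : ∀ i t, curve i (t + 2 * Real.pi) = curve i t
  immersed : ∀ i t, deriv (curve i) t ≠ 0
  embedded : ∀ i j s t, curve i s = curve j t → i = j ∧ ∃ m : ℤ, s = t + 2 * Real.pi * m

/-- Oriented isotopy of links: a smooth ambient isotopy of three-space (starting at the identity)
whose time-one map carries every component of `L` onto a component of `L'`, preserving the
orientations; the components may be interchanged. -/
def OrientedLink.Isotopic {k : ℕ} (L L' : OrientedLink k) : Prop :=
  ∃ F : ℝ → Space ≃ Space,
    ContDiff ℝ ∞ (fun u : ℝ × Space => F u.1 u.2) ∧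
    ContDiff ℝ ∞ (fun u : ℝ × Space => (F u.1).symm u.2) ∧
    (∀ x, F 0 x = x) ∧
    ∃ (σ : Equiv.Perm (Fin k)) (φ : Fin k → ℝ → ℝ),
      ∀ i, Continuous (φ i) ∧ StrictMono (φ i) ∧
        (∀ t, φ i (t + 2 * Real.pi) = φ i t + 2 * Real.pi) ∧
        ∀ t, F 1 (L.curve i t) = L'.curve (σ i) (φ i t)

/-- The continued fraction `1 / (b₁ + 1 / (b₂ + ⋯ + 1 / bₙ))`. -/
def contFrac : List ℤ → ℚ
  | [] => 0
  | b :: l => 1 / ((b : ℚ) + contFrac l)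

/-- `b` is a canonical expansion of `p / q` (for an even denominator `q`): all its entries are
nonzero and even, and there is an odd number of them. -/
structure IsCanonicalExpansion (p q : ℤ) (b : List ℤ) : Prop where
  ne_zero : ∀ a ∈ b, a ≠ 0
  even : ∀ a ∈ b, Even a
  odd_length : Odd b.length
  value : contFrac b = (p : ℚ) / (q : ℚ)

/-! ### The space curves with a canonical diagram

Four strands run from left to right. The `i`-th block of the word `A^(b 0) B^(b 1) A^(b 2) ⋯` lies
over `i ≤ x ≤ i + 1`; in a block `A^b` the two middle strands make `b` right-handed half-twists, in a
block `B^b` the two upper strands make `b` left-handed half-twists. The two upper strands are joined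
at both ends, and so are the two lower ones. Without the twists these are the two ellipses
`x = n / 2 - (n / 2 + 1) cos t, y = ± 2 - sin t`, whose leftmost points (`t = 0`) are both passed
downwards, hence in the same direction; this is the positive orientation. The points of the plane `x = const` are written as
complex numbers `y + i z`. -/

/-- The angle by which the two middle strands have been turned around each other. -/
def middleAngle (b : List ℤ) (x : ℝ) : ℝ :=
  ∑ i : Fin b.length,
    if Even (i : ℕ) then Real.pi * (b.get i : ℝ) * Real.smoothTransition (x - (i : ℕ)) else 0

/-- The angle by which the two upper strands have been turned around each other. -/
def upperAngle (b : List ℤ) (x : ℝ) : ℝ :=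
  ∑ i : Fin b.length,
    if Even (i : ℕ) then 0 else -(Real.pi * (b.get i : ℝ) * Real.smoothTransition (x - (i : ℕ)))

/-- The point with first coordinate `x` and the other two the real and imaginary part of `w`. -/
def place (x : ℝ) (w : ℂ) : Space := !₂[x, w.re, w.im]

/-- The first coordinate of both ellipses, for `n` blocks. -/
def axial (n : ℕ) (t : ℝ) : ℝ := (n : ℝ) / 2 - ((n : ℝ) / 2 + 1) * Real.cos t

/-- The unit complex number with argument `θ`. -/
def unitAt (θ : ℝ) : ℂ := Complex.exp ((θ : ℂ) * Complex.I)

/-- The upper component: the second strand (from above) for `sin t > 0`, run from left to right, and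
the first strand for `sin t < 0`, run from right to left. -/
def upperPoint (b : List ℤ) (t : ℝ) : ℂ :=
  (if 0 < Real.sin t then unitAt (middleAngle b (axial b.length t)) else 1) *
    (2 - (Real.sin t : ℂ) * unitAt (upperAngle b (axial b.length t)))

/-- The lower component: the fourth strand for `sin t > 0`, run from left to right, and the third
strand for `sin t < 0`, run from right to left. -/
def lowerPoint (b : List ℤ) (t : ℝ) : ℂ :=
  (if Real.sin t < 0 then unitAt (middleAngle b (axial b.length t)) else 1) *
    (-2 - (Real.sin t : ℂ))

/-- The two oriented space curves with the diagram `D⁺[b₁, …, bₙ]` (all `bᵢ` even, `n` odd). -/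
def canonicalCurve (b : List ℤ) (k : Fin 2) (t : ℝ) : Space :=
  place (axial b.length t) (if k = 0 then upperPoint b t else lowerPoint b t)

/-! ### These curves form a link -/

theorem unitAt_of_even {a : ℤ} (ha : Even a) : unitAt (Real.pi * (a : ℝ)) = 1 := by
  obtain ⟨c, rfl⟩ := ha
  unfold unitAt
  rw [Complex.exp_eq_one_iff]
  exact ⟨c, by push_cast; ring⟩

theorem norm_unitAt (θ : ℝ) : ‖unitAt θ‖ = 1 := Complex.norm_exp_ofReal_mul_I θ

theorem unitAt_sum {ι : Type*} (s : Finset ι) (f : ι → ℝ) (h : ∀ i ∈ s, unitAt (f i) = 1) :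
    unitAt (∑ i ∈ s, f i) = 1 := by
  have : unitAt (∑ i ∈ s, f i) = ∏ i ∈ s, unitAt (f i) := by
    unfold unitAt
    rw [Complex.ofReal_sum, Finset.sum_mul, Complex.exp_sum]
  rw [this]
  exact Finset.prod_eq_one h

theorem unitAt_neg {θ : ℝ} (h : unitAt θ = 1) : unitAt (-θ) = 1 := by
  unfold unitAt at *
  rw [Complex.ofReal_neg, neg_mul, Complex.exp_neg, h, inv_one]

theorem unitAt_zero : unitAt 0 = 1 := by simp [unitAt]

theorem unitAt_block {a : ℤ} (ha : Even a) {y : ℝ} (hy : y ≤ 0 ∨ 1 ≤ y) :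
    unitAt (Real.pi * (a : ℝ) * Real.smoothTransition y) = 1 := by
  rcases hy with hy | hy
  · rw [Real.smoothTransition.zero_of_nonpos hy, mul_zero, unitAt_zero]
  · rw [Real.smoothTransition.one_of_one_le hy, mul_one, unitAt_of_even ha]

theorem unitAt_middle {b : List ℤ} (hb : ∀ a ∈ b, Even a) {x : ℝ}
    (hx : ∀ i : ℕ, i < b.length → Even i → x ≤ i ∨ (i : ℝ) + 1 ≤ x) :
    unitAt (middleAngle b x) = 1 := by
  refine unitAt_sum _ _ fun i _ => ?_
  split_ifs with h
  · refine unitAt_block (hb _ (List.get_mem b i)) ?_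
    rcases hx i i.2 h with h | h
    · left; linarith
    · right; linarith
  · exact unitAt_zero

theorem unitAt_upper {b : List ℤ} (hb : ∀ a ∈ b, Even a) {x : ℝ}
    (hx : ∀ i : ℕ, i < b.length → ¬ Even i → x ≤ i ∨ (i : ℝ) + 1 ≤ x) :
    unitAt (upperAngle b x) = 1 := by
  refine unitAt_sum _ _ fun i _ => ?_
  split_ifs with h
  · exact unitAt_zero
  · refine unitAt_neg (unitAt_block (hb _ (List.get_mem b i)) ?_)
    rcases hx i i.2 h with h | h
    · left; linarith
    · right; linarith

theorem outside_block {n : ℕ} {x : ℝ} (hx : x ≤ 0 ∨ (n : ℝ) ≤ x) (i : ℕ) (hi : i < n) :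
    x ≤ i ∨ (i : ℝ) + 1 ≤ x := by
  have h0 : (0 : ℝ) ≤ i := Nat.cast_nonneg i
  have h1 : (i : ℝ) + 1 ≤ n := by exact_mod_cast hi
  rcases hx with hx | hx
  · left; linarith
  · right; linarith

/-- At every place at most one of the two pairs of strands is being twisted. -/
theorem unitAt_middle_or_upper {b : List ℤ} (hb : ∀ a ∈ b, Even a) (x : ℝ) :
    unitAt (middleAngle b x) = 1 ∨ unitAt (upperAngle b x) = 1 := by
  by_contra hcon
  rw [not_or] at hcon
  obtain ⟨h1, h2⟩ := hcon
  have e1 : ∃ i : ℕ, Even i ∧ (i : ℝ) < x ∧ x < i + 1 := by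
    by_contra hne
    push Not at hne
    refine h1 (unitAt_middle hb fun i _ hi => ?_)
    by_cases h : x ≤ i
    · exact Or.inl h
    · exact Or.inr (hne i hi (lt_of_not_ge h))
  have e2 : ∃ i : ℕ, ¬ Even i ∧ (i : ℝ) < x ∧ x < i + 1 := by
    by_contra hne
    push Not at hne
    refine h2 (unitAt_upper hb fun i _ hi => ?_)
    by_cases h : x ≤ i
    · exact Or.inl h
    · exact Or.inr (hne i hi (lt_of_not_ge h))
  obtain ⟨i, hi, hi1, hi2⟩ := e1
  obtain ⟨j, hj, hj1, hj2⟩ := e2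
  have a1 : (i : ℝ) < j + 1 := by linarith
  have a2 : (j : ℝ) < i + 1 := by linarith
  have a3 : i < j + 1 := by exact_mod_cast a1
  have a4 : j < i + 1 := by exact_mod_cast a2
  have : i = j := by omega
  exact hj (this ▸ hi)

theorem contDiff_unitAt : ContDiff ℝ ∞ unitAt := by
  unfold unitAt
  exact Complex.contDiff_exp.comp (Complex.ofRealCLM.contDiff.mul contDiff_const)

theorem contDiff_middleAngle (b : List ℤ) : ContDiff ℝ ∞ (middleAngle b) := by
  unfold middleAngle
  refine ContDiff.sum fun i _ => ?_
  split_ifs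
  · exact contDiff_const.mul
      (Real.smoothTransition.contDiff.comp (contDiff_id.sub contDiff_const))
  · exact contDiff_const

theorem contDiff_upperAngle (b : List ℤ) : ContDiff ℝ ∞ (upperAngle b) := by
  unfold upperAngle
  refine ContDiff.sum fun i _ => ?_
  split_ifs
  · exact contDiff_const
  · exact (contDiff_const.mul
      (Real.smoothTransition.contDiff.comp (contDiff_id.sub contDiff_const))).neg

theorem contDiff_axial (n : ℕ) : ContDiff ℝ ∞ (axial n) :=
  contDiff_const.sub (contDiff_const.mul Real.contDiff_cos)

theorem contDiff_place {f : ℝ → ℝ} {g : ℝ → ℂ} (hf : ContDiff ℝ ∞ f) (hg : ContDiff ℝ ∞ g) :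
    ContDiff ℝ ∞ (fun t => place (f t) (g t)) := by
  unfold place
  rw [contDiff_euclidean]
  intro i
  fin_cases i
  · exact hf
  · exact Complex.reCLM.contDiff.comp hg
  · exact Complex.imCLM.contDiff.comp hg

/-- Near the ends of the diagram there are no twists. -/
theorem eventually_outside (n : ℕ) {t : ℝ} (ht : Real.sin t = 0) :
    ∀ᶠ s in nhds t, axial n s ≤ 0 ∨ (n : ℝ) ≤ axial n s := by
  have hn : (0 : ℝ) ≤ n := Nat.cast_nonneg n
  have hc : Continuous (axial n) := (contDiff_axial n).continuous
  rcases Real.sin_eq_zero_iff_cos_eq.mp ht with h | h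
  · have h1 : axial n t < 0 := by unfold axial; rw [h]; linarith
    filter_upwards [hc.continuousAt.eventually (gt_mem_nhds h1)] with s hs using Or.inl hs.le
  · have h1 : (n : ℝ) < axial n t := by unfold axial; rw [h]; linarith
    filter_upwards [hc.continuousAt.eventually (lt_mem_nhds h1)] with s hs using Or.inr hs.le

theorem contDiff_cutoff {b : List ℤ} (hb : ∀ a ∈ b, Even a) {σ : ℝ → ℝ} (hσ : Continuous σ)
    (h0 : ∀ t, σ t = 0 → Real.sin t = 0) :
    ContDiff ℝ ∞
      (fun t => if 0 < σ t then unitAt (middleAngle b (axial b.length t)) else (1 : ℂ)) := by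
  rw [contDiff_iff_contDiffAt]
  intro t
  have hm : ContDiff ℝ ∞ (fun t => unitAt (middleAngle b (axial b.length t))) :=
    contDiff_unitAt.comp ((contDiff_middleAngle b).comp (contDiff_axial _))
  rcases lt_trichotomy (σ t) 0 with h | h | h
  · refine (contDiffAt_const (c := (1 : ℂ))).congr_of_eventuallyEq ?_
    filter_upwards [hσ.continuousAt.eventually (gt_mem_nhds h)] with s hs
    rw [if_neg (not_lt.mpr hs.le)]
  · refine (contDiffAt_const (c := (1 : ℂ))).congr_of_eventuallyEq ?_
    filter_upwards [eventually_outside b.length (h0 t h)] with s hs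
    rw [unitAt_middle hb fun i hi _ => outside_block hs i hi, ite_self]
  · refine hm.contDiffAt.congr_of_eventuallyEq ?_
    filter_upwards [hσ.continuousAt.eventually (lt_mem_nhds h)] with s hs
    rw [if_pos hs]

theorem contDiff_upperPoint {b : List ℤ} (hb : ∀ a ∈ b, Even a) :
    ContDiff ℝ ∞ (upperPoint b) := by
  unfold upperPoint
  refine (contDiff_cutoff hb Real.continuous_sin fun _ h => h).mul (contDiff_const.sub ?_)
  exact (Complex.ofRealCLM.contDiff.comp Real.contDiff_sin).mul
    (contDiff_unitAt.comp ((contDiff_upperAngle b).comp (contDiff_axial _)))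

theorem contDiff_lowerPoint {b : List ℤ} (hb : ∀ a ∈ b, Even a) :
    ContDiff ℝ ∞ (lowerPoint b) := by
  have h := (contDiff_cutoff hb (σ := fun t => -Real.sin t) Real.continuous_sin.neg
    fun _ h => neg_eq_zero.mp h).mul
    (contDiff_const (c := (-2 : ℂ)) |>.sub (Complex.ofRealCLM.contDiff.comp Real.contDiff_sin))
  have e : lowerPoint b = fun t =>
      (if 0 < -Real.sin t then unitAt (middleAngle b (axial b.length t)) else (1 : ℂ)) *
        (-2 - (Real.sin t : ℂ)) := by
    funext t
    simp only [lowerPoint, neg_pos]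
  rw [e]
  exact h

theorem contDiff_canonicalCurve {b : List ℤ} (hb : ∀ a ∈ b, Even a) (k : Fin 2) :
    ContDiff ℝ ∞ (canonicalCurve b k) := by
  unfold canonicalCurve
  refine contDiff_place (contDiff_axial _) ?_
  split_ifs
  · exact contDiff_upperPoint hb
  · exact contDiff_lowerPoint hb

theorem deriv_coord {f : ℝ → Space} (hf : ContDiff ℝ ∞ f) {t : ℝ} (h : deriv f t = 0)
    (i : Fin 3) : deriv (fun s => f s i) t = 0 := by
  have hd : HasDerivAt f 0 t := by
    rw [← h]
    exact (hf.differentiable (by simp)).differentiableAt.hasDerivAt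
  have := (EuclideanSpace.proj i : Space →L[ℝ] ℝ).hasFDerivAt.comp_hasDerivAt t hd
  rw [map_zero] at this
  exact this.deriv

theorem canonicalCurve_immersed {b : List ℤ} (hb : ∀ a ∈ b, Even a) (k : Fin 2) (t : ℝ) :
    deriv (canonicalCurve b k) t ≠ 0 := by
  intro h
  have h0 := deriv_coord (contDiff_canonicalCurve hb k) h 0
  have hs : Real.sin t = 0 := by
    have e : (fun s => canonicalCurve b k s 0) = axial b.length := by
      funext s; simp [canonicalCurve, place]
    have hd : HasDerivAt (axial b.length) (-(((b.length : ℝ) / 2 + 1) * -Real.sin t)) t :=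
      ((Real.hasDerivAt_cos t).const_mul _).const_sub _
    rw [e, hd.deriv] at h0
    have hn : ((b.length : ℝ) / 2 + 1) ≠ 0 := by positivity
    simpa [hn] using h0
  have h1 := deriv_coord (contDiff_canonicalCurve hb k) h 1
  have e : (fun s => canonicalCurve b k s 1) =ᶠ[nhds t]
      fun s => (if k = 0 then 2 else -2 : ℝ) - Real.sin s := by
    filter_upwards [eventually_outside b.length hs] with s hs
    have m1 := unitAt_middle hb fun i hi _ => outside_block hs i hi
    have m2 := unitAt_upper hb fun i hi _ => outside_block hs i hi
    by_cases hk : k = 0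
    · simp only [canonicalCurve, place, upperPoint, m1, m2, hk, if_true, ite_self, mul_one, one_mul]
      simp [-Complex.ofReal_sin]
    · simp only [canonicalCurve, place, lowerPoint, m1, hk, if_false, ite_self, one_mul]
      simp [-Complex.ofReal_sin]
  rw [e.deriv_eq, ((Real.hasDerivAt_sin t).const_sub _).deriv, neg_eq_zero] at h1
  have := Real.sin_sq_add_cos_sq t
  rw [hs, h1] at this
  norm_num at this

theorem canonicalCurve_eq {b : List ℤ} {i j : Fin 2} {s t : ℝ}
    (h : canonicalCurve b i s = canonicalCurve b j t) :
    axial b.length s = axial b.length t ∧ Real.cos s = Real.cos t ∧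
      (if i = 0 then upperPoint b s else lowerPoint b s) =
        (if j = 0 then upperPoint b t else lowerPoint b t) := by
  have c0 : axial b.length s = axial b.length t := by
    simpa [canonicalCurve, place] using congrArg (fun v : Space => v 0) h
  have c1 := congrArg (fun v : Space => v 1) h
  have c2 := congrArg (fun v : Space => v 2) h
  refine ⟨c0, ?_, Complex.ext (by simpa [canonicalCurve, place] using c1)
    (by simpa [canonicalCurve, place] using c2)⟩
  have hn : ((b.length : ℝ) / 2 + 1) ≠ 0 := by positivity
  unfold axial at c0
  exact mul_left_cancel₀ hn (by linarith)

/-- The opposite strands of the upper component are disjoint. -/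
theorem strands_ne {m u : ℂ} (hm : ‖m‖ = 1) (hu : ‖u‖ = 1) (h : m = 1 ∨ u = 1) {r : ℝ}
    (hr : 0 < r) (hr1 : r ≤ 1) : m * (2 - r * u) ≠ 2 + r * u := by
  intro e
  have hu0 : u ≠ 0 := by rw [← norm_ne_zero_iff, hu]; norm_num
  rcases h with h | h
  · rw [h, one_mul] at e
    have : (2 * r : ℂ) * u = 0 := by linear_combination -e
    simp [hu0, hr.ne'] at this
  · rw [h, mul_one] at e
    have e2 := congrArg norm e
    rw [norm_mul, hm, one_mul] at e2
    have n1 : ‖(2 - r : ℂ)‖ = 2 - r := by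
      rw [show (2 - r : ℂ) = ((2 - r : ℝ) : ℂ) by push_cast; ring, Complex.norm_real,
        Real.norm_of_nonneg (by linarith)]
    have n2 : ‖(2 + r : ℂ)‖ = 2 + r := by
      rw [show (2 + r : ℂ) = ((2 + r : ℝ) : ℂ) by push_cast; ring, Complex.norm_real,
        Real.norm_of_nonneg (by linarith)]
    rw [n1, n2] at e2
    linarith

theorem upper_ne_lower {b : List ℤ} (hb : ∀ a ∈ b, Even a) {s t : ℝ}
    (hx : axial b.length s = axial b.length t) (hc : Real.cos s = Real.cos t) :
    upperPoint b s ≠ lowerPoint b t := by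
  intro e
  have hss := Real.sin_sq_add_cos_sq s
  have hst := Real.sin_sq_add_cos_sq t
  have b1 := Real.sin_le_one s
  have b2 := Real.neg_one_le_sin s
  have b3 := Real.sin_le_one t
  have b4 := Real.neg_one_le_sin t
  have hsq : (Real.sin s - Real.sin t) * (Real.sin s + Real.sin t) = 0 := by
    rw [hc] at hss; linarith
  unfold upperPoint lowerPoint at e
  rw [hx] at e
  have hm := norm_unitAt (middleAngle b (axial b.length t))
  have hu := norm_unitAt (upperAngle b (axial b.length t))
  have hor := unitAt_middle_or_upper hb (axial b.length t)
  generalize unitAt (middleAngle b (axial b.length t)) = m at *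
  generalize unitAt (upperAngle b (axial b.length t)) = u at *
  generalize Real.sin s = x at *
  generalize Real.sin t = y at *
  rcases hor with rfl | rfl
  · simp only [ite_self, one_mul] at e
    have e1 := congrArg Complex.re e
    have hre : |x * u.re| ≤ 1 := by
      rw [abs_mul]
      have h1 : |x| ≤ 1 := abs_le.mpr ⟨b2, b1⟩
      have h2 : |u.re| ≤ 1 := hu ▸ Complex.abs_re_le_norm u
      calc |x| * |u.re| ≤ 1 * 1 := mul_le_mul h1 h2 (abs_nonneg _) zero_le_one
        _ = 1 := one_mul 1
    have := (abs_le.mp hre).2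
    simp at e1
    linarith
  · rw [mul_one] at e
    have key : (2 - x = 2 + y) := by
      have e2 := congrArg norm e
      have k1 : ‖(if 0 < x then m else 1 : ℂ)‖ = 1 := by split_ifs <;> simp [hm]
      have k2 : ‖(if y < 0 then m else 1 : ℂ)‖ = 1 := by split_ifs <;> simp [hm]
      rw [norm_mul, norm_mul, k1, k2, one_mul, one_mul,
        show (2 - x : ℂ) = ((2 - x : ℝ) : ℂ) by push_cast; ring,
        show (-2 - y : ℂ) = ((-(2 + y) : ℝ) : ℂ) by push_cast; ring, Complex.norm_real,
        Complex.norm_real, norm_neg, Real.norm_of_nonneg (by linarith),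
        Real.norm_of_nonneg (by linarith)] at e2
      exact e2
    have hy : y = -x := by linarith
    subst hy
    have hne : (2 - x : ℂ) ≠ 0 := by
      rw [show (2 - x : ℂ) = ((2 - x : ℝ) : ℂ) by push_cast; ring]
      exact_mod_cast (show (2 - x : ℝ) ≠ 0 by linarith)
    have hm0 : (if 0 < x then m else 1 : ℂ) ≠ 0 := by
      rw [← norm_ne_zero_iff]
      split_ifs <;> simp [hm]
    have e3 : (if 0 < x then m else 1 : ℂ) * (2 - x) = 0 := by
      have : (if -x < 0 then m else 1 : ℂ) = if 0 < x then m else 1 := by simp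
      rw [this] at e
      push_cast at e
      linear_combination e / 2
    exact mul_ne_zero hm0 hne e3

theorem same_component {s t : ℝ} (hc : Real.cos s = Real.cos t) :
    (∃ m : ℤ, s = t + 2 * Real.pi * m) ∨ (Real.sin s = -Real.sin t ∧ Real.sin t ≠ 0) := by
  by_cases h0 : Real.sin t = 0
  · left
    obtain ⟨k, hk⟩ := Real.sin_eq_zero_iff.mp h0
    obtain ⟨m, hm | hm⟩ := Real.cos_eq_cos_iff.mp hc
    · exact ⟨-m, by push_cast; linarith⟩
    · exact ⟨m - k, by push_cast; linarith⟩
  · obtain ⟨m, hm | hm⟩ := Real.cos_eq_cos_iff.mp hc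
    · exact Or.inl ⟨-m, by push_cast; linarith⟩
    · right
      refine ⟨?_, h0⟩
      have : s = -t + m * (2 * Real.pi) := by linarith
      rw [this, Real.sin_add_int_mul_two_pi, Real.sin_neg]

theorem canonicalCurve_embedded {b : List ℤ} (hb : ∀ a ∈ b, Even a) (i j : Fin 2) (s t : ℝ)
    (h : canonicalCurve b i s = canonicalCurve b j t) :
    i = j ∧ ∃ m : ℤ, s = t + 2 * Real.pi * m := by
  obtain ⟨hx, hc, hw⟩ := canonicalCurve_eq h
  have hm := norm_unitAt (middleAngle b (axial b.length t))
  have hu := norm_unitAt (upperAngle b (axial b.length t))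
  have hor := unitAt_middle_or_upper hb (axial b.length t)
  have b3 := Real.sin_le_one t
  have b4 := Real.neg_one_le_sin t
  fin_cases i <;> fin_cases j
  · refine ⟨rfl, (same_component hc).resolve_right ?_⟩
    rintro ⟨hs, h0⟩
    simp only [Fin.zero_eta, if_true, upperPoint, hx, hs] at hw
    rcases lt_or_gt_of_ne h0 with h1 | h1
    · rw [if_pos (by linarith), if_neg (by linarith), one_mul] at hw
      refine strands_ne hm hu hor (r := -Real.sin t) (by linarith) (by linarith) ?_
      rw [hw]; push_cast; ring
    · rw [if_neg (by linarith), if_pos h1, one_mul] at hw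
      refine strands_ne hm hu hor (r := Real.sin t) h1 b3 ?_
      rw [← hw]; push_cast; ring
  · exact absurd (by simpa using hw) (upper_ne_lower hb hx hc)
  · exact absurd (by simpa using hw.symm) (upper_ne_lower hb hx.symm hc.symm)
  · refine ⟨rfl, (same_component hc).resolve_right ?_⟩
    rintro ⟨hs, h0⟩
    simp only [Fin.mk_one, one_ne_zero, if_false, lowerPoint, hx, hs] at hw
    rcases lt_or_gt_of_ne h0 with h1 | h1
    · rw [if_neg (by linarith), if_pos h1, one_mul] at hw
      refine strands_ne hm norm_one (Or.inr rfl) (r := -Real.sin t) (by linarith) (by linarith) ?_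
      push_cast at hw ⊢
      linear_combination hw
    · rw [if_pos (by linarith), if_neg (by linarith), one_mul] at hw
      refine strands_ne hm norm_one (Or.inr rfl) (r := Real.sin t) h1 b3 ?_
      push_cast at hw ⊢
      linear_combination -hw

/-- The oriented link with the canonical diagram `D⁺[b₁, …, bₙ]` (all `bᵢ` even, `n` odd). -/
def canonicalLink (b : List ℤ) (hb : ∀ a ∈ b, Even a) : OrientedLink 2 where
  curve := canonicalCurve b
  smooth := contDiff_canonicalCurve hb
  periodic k t := by
    simp [canonicalCurve, upperPoint, lowerPoint, axial]
  immersed := canonicalCurve_immersed hb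
  embedded := canonicalCurve_embedded hb

/-! ### Existence of canonical expansions -/

theorem exists_even_quotient {p q : ℤ} (hp : p ≠ 0) : ∃ c : ℤ, |q - 2 * c * p| ≤ |p| := by
  have hpos : 0 < |p| := abs_pos.mpr hp
  have h1 := Int.emod_nonneg (q + |p|) (show 2 * |p| ≠ 0 by positivity)
  have h2 := Int.emod_lt_of_pos (q + |p|) (show 0 < 2 * |p| by positivity)
  have h3 := Int.emod_add_mul_ediv (q + |p|) (2 * |p|)
  have key : abs (q - 2 * ((q + |p|) / (2 * |p|)) * |p|) ≤ |p| := by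
    rw [abs_le]
    constructor <;> nlinarith
  rcases abs_choice p with h | h
  · exact ⟨(q + |p|) / (2 * |p|), by rw [h] at key ⊢; exact key⟩
  · refine ⟨-((q + |p|) / (2 * |p|)), ?_⟩
    convert key using 2
    rw [h]; ring

theorem exists_even_expansion (k : ℕ) : ∀ p q : ℤ, q.natAbs ≤ k → IsCoprime p q → |p| < |q| →
    (Even p ↔ ¬ Even q) → ∃ b : List ℤ, (∀ a ∈ b, a ≠ 0) ∧ (∀ a ∈ b, Even a) ∧
      (Even b.length ↔ ¬ Even q) ∧ contFrac b = (p : ℚ) / q := by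
  induction k with
  | zero =>
    intro p q hk _ hlt _
    have : q = 0 := by omega
    subst this
    exact absurd hlt (by simp)
  | succ k ih =>
    intro p q hk hco hlt hpar
    by_cases hp : p = 0
    · subst hp
      exact ⟨[], by simp, by simp, by simpa using hpar, by simp [contFrac]⟩
    obtain ⟨c, hc⟩ := exists_even_quotient (q := q) hp
    have hco' : IsCoprime (q - 2 * c * p) p := by
      have := hco.symm.add_mul_right_left (-(2 * c))
      rwa [show q + -(2 * c) * p = q - 2 * c * p by ring] at this
    have hpar' : Even (q - 2 * c * p) ↔ ¬ Even p := by
      have : Even (q - 2 * c * p) ↔ Even q := by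
        have h2 : Even (2 * c * p) := ⟨c * p, by ring⟩
        rw [Int.even_sub]; tauto
      tauto
    have hlt' : |q - 2 * c * p| < |p| := by
      refine lt_of_le_of_ne hc fun he => ?_
      rcases abs_eq_abs.mp he with h | h
      · rw [h] at hpar'; tauto
      · rw [h, even_neg] at hpar'; tauto
    have hk' : p.natAbs ≤ k := by
      rw [Int.abs_eq_natAbs, Int.abs_eq_natAbs] at hlt
      omega
    obtain ⟨b, h1, h2, h3, h4⟩ := ih (q - 2 * c * p) p hk' hco' hlt' hpar'
    refine ⟨2 * c :: b, ?_, ?_, ?_, ?_⟩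
    · intro a ha
      rcases List.mem_cons.mp ha with rfl | ha
      · intro h0
        rw [h0, zero_mul, sub_zero] at hc
        exact absurd hc (not_le.mpr hlt)
      · exact h1 a ha
    · intro a ha
      rcases List.mem_cons.mp ha with rfl | ha
      · exact ⟨c, by ring⟩
      · exact h2 a ha
    · rw [List.length_cons, Nat.even_add_one, h3]
      tauto
    · have hp' : (p : ℚ) ≠ 0 := by exact_mod_cast hp
      rw [contFrac, h4]
      push_cast
      rw [show (2 * (c : ℚ) + (q - 2 * c * p) / p) = q / p by field_simp; ring, one_div_div]

theorem exists_canonicalExpansion {p q : ℤ} (hco : IsCoprime p q) (hq : Even q)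
    (hlt : |p| < |q|) : ∃ b : List ℤ, IsCanonicalExpansion p q b := by
  have hpar : Even p ↔ ¬ Even q := by
    refine ⟨fun hp => ?_, fun h => absurd hq h⟩
    have := hco.isUnit_of_dvd' hp.two_dvd hq.two_dvd
    rw [Int.isUnit_iff] at this
    omega
  obtain ⟨b, h1, h2, h3, h4⟩ := exists_even_expansion _ p q le_rfl hco hlt hpar
  exact ⟨b, h1, h2, Nat.not_even_iff_odd.mp (by tauto), h4⟩

/-- The oriented rational link `L⁺(p/q)`, for coprime `p` and `q` with `q` even and `|p/q| < 1`,
given by the canonical diagram, that is, by the (unique) canonical expansion of `p/q`. -/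
def rationalLink (p q : ℤ) (hco : IsCoprime p q) (hq : Even q) (hlt : |p| < |q|) :
    OrientedLink 2 :=
  canonicalLink (exists_canonicalExpansion hco hq hlt).choose
    (exists_canonicalExpansion hco hq hlt).choose_spec.even

end

noncomputable section

/-! ### Even continued fractions and their reversal -/

/-! The arithmetic half shows that passing from `p/q` to `p̄/q` reverses the word. Write the product
of the matrices `!![0, 1; 1, bᵢ]` as `!![a, P; P', Q]`. Then `P/Q` is the value of the expansion,
and reversing the word transposes the product, so `P'/Q` is the value of the reversed expansion. For
an odd number of even entries the determinant is -1 and `a` is even, hence `P P' ≡ 1` modulo `2 Q`.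
Since even expansions have values of absolute value below 1, this congruence identifies `P'/Q` with
`p̄/q` (`IsCanonicalExpansion.reverse`), and even expansions are unique (`contFrac_injective`).

The geometric half shows that reversing the word preserves the oriented link. A half-turn about a
vertical line through the middle of the diagram carries the curves of `b` exactly onto those of
`b.reverse`, but reverses both orientations (`halfTurn_canonicalCurve`). It remains to reverse both
components of one canonical link by an ambient isotopy (`exists_diffeotopic_reversing`).

For this, note that each plane `x = const` strictly between the ends of the curves meets each
component in two points, and that some Möbius involution `w ↦ (k - E w) / (w + E)` exchanges the
points of both pairs at once. Here `E` and `k` are explicit smooth functions of `x`. Möbius maps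
need the point at infinity, so a diffeomorphism `spherify` first bends the relevant parts of the
planes into concentric spheres, where the involutions act globally. Replacing the parameters at
radius `R` by those at `s R` and letting `s` tend to 0 deforms the family of involutions to `w ↦ 1 /
w` on every sphere. That is a rigid half-turn of space, hence isotopic to the identity. -/

theorem two_le_abs_of_even {a : ℤ} (h0 : a ≠ 0) (he : Even a) : (2 : ℚ) ≤ |(a : ℚ)| := by
  obtain ⟨c, rfl⟩ := he
  have : (2 : ℤ) ≤ |c + c| := by
    rcases lt_or_gt_of_ne h0 with h | h
    · rw [abs_of_neg h]; omega
    · rw [abs_of_pos h]; omega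
  exact_mod_cast this

/-- An entry of absolute value at least 2 plus a tail below 1 exceeds 1 in absolute value, so its
inverse is again below 1. In particular no denominator vanishes and the convention `1 / 0 = 0` never
enters. -/
theorem abs_contFrac_lt_one {l : List ℤ} (h0 : ∀ a ∈ l, a ≠ 0) (he : ∀ a ∈ l, Even a) :
    |contFrac l| < 1 := by
  induction l with
  | nil => simp [contFrac]
  | cons b l ih =>
    have ih := ih (fun a ha => h0 a (List.mem_cons_of_mem _ ha))
      (fun a ha => he a (List.mem_cons_of_mem _ ha))
    have hb := two_le_abs_of_even (h0 b List.mem_cons_self) (he b List.mem_cons_self)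
    have h : 1 < |(b : ℚ) + contFrac l| := by
      have := abs_sub_abs_le_abs_sub (b : ℚ) (-contFrac l)
      rw [abs_neg, sub_neg_eq_add] at this
      linarith
    rw [contFrac, abs_div, abs_one]
    exact (div_lt_one (by linarith)).mpr h

theorem add_contFrac_ne_zero {b : ℤ} {l : List ℤ} (h0 : ∀ a ∈ b :: l, a ≠ 0)
    (he : ∀ a ∈ b :: l, Even a) : (b : ℚ) + contFrac l ≠ 0 := by
  intro h
  have h1 := abs_contFrac_lt_one (fun a ha => h0 a (List.mem_cons_of_mem b ha))
    (fun a ha => he a (List.mem_cons_of_mem b ha))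
  have hb := two_le_abs_of_even (h0 b List.mem_cons_self) (he b List.mem_cons_self)
  rw [eq_neg_of_add_eq_zero_left h, abs_neg] at hb
  linarith

/-- An expansion with nonzero even entries is determined by its value. -/
theorem contFrac_injective {l l' : List ℤ} (h0 : ∀ a ∈ l, a ≠ 0) (he : ∀ a ∈ l, Even a)
    (h0' : ∀ a ∈ l', a ≠ 0) (he' : ∀ a ∈ l', Even a) (h : contFrac l = contFrac l') :
    l = l' := by
  induction l generalizing l' with
  | nil =>
    cases l' with
    | nil => rfl
    | cons b l' =>
      have := add_contFrac_ne_zero h0' he'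
      simp only [contFrac] at h
      exact absurd h.symm (one_div_ne_zero this)
  | cons b l ih =>
    cases l' with
    | nil =>
      have := add_contFrac_ne_zero h0 he
      simp only [contFrac] at h
      exact absurd h (one_div_ne_zero this)
    | cons b' l' =>
      simp only [contFrac, one_div, inv_inj] at h
      have t0 := fun a ha => h0 a (List.mem_cons_of_mem b ha)
      have te := fun a ha => he a (List.mem_cons_of_mem b ha)
      have t0' := fun a ha => h0' a (List.mem_cons_of_mem b' ha)
      have te' := fun a ha => he' a (List.mem_cons_of_mem b' ha)
      have h1 := abs_lt.mp (abs_contFrac_lt_one t0 te)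
      have h2 := abs_lt.mp (abs_contFrac_lt_one t0' te')
      -- Both tails lie in (-1, 1), so the first entries differ by less than 2; being even, they
      -- agree.
      have hlt : (b : ℚ) < b' + 2 := by linarith
      have hgt : (b' : ℚ) < b + 2 := by linarith
      have hlt' : b < b' + 2 := by exact_mod_cast hlt
      have hgt' : b' < b + 2 := by exact_mod_cast hgt
      obtain ⟨c, hc⟩ := he b List.mem_cons_self
      obtain ⟨c', hc'⟩ := he' b' List.mem_cons_self
      have hb : b = b' := by omega
      subst hb
      rw [ih t0 te t0' te' (add_left_cancel h)]

/-! ### Continued fractions as matrix products -/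

/-- The product of the matrices `!![0, 1; 1, b]` over the entries of a list. -/
def contMatrix (l : List ℤ) : Matrix (Fin 2) (Fin 2) ℤ :=
  (l.map fun b => !![0, 1; 1, b]).prod

theorem contMatrix_cons (b : ℤ) (l : List ℤ) :
    contMatrix (b :: l) = !![0, 1; 1, b] * contMatrix l := by simp [contMatrix]

/-- Every factor is symmetric, so transposing the product only reverses the order of the factors. -/
theorem contMatrix_reverse (l : List ℤ) : contMatrix l.reverse = (contMatrix l).transpose := by
  unfold contMatrix
  rw [Matrix.transpose_list_prod, List.map_map, List.map_reverse]
  congr 2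
  refine List.map_congr_left fun b _ => ?_
  ext i j
  fin_cases i <;> fin_cases j <;> rfl

theorem det_contMatrix (l : List ℤ) : (contMatrix l).det = (-1) ^ l.length := by
  induction l with
  | nil => simp [contMatrix]
  | cons b l ih => rw [contMatrix_cons, Matrix.det_mul, ih]; simp [Matrix.det_fin_two, pow_succ]

/-- Prepending `b` sends the second column `(P, Q)` to `(Q, P + b Q)`, which is the recursion for
numerator and denominator. -/
theorem contFrac_eq_div {l : List ℤ} (h0 : ∀ a ∈ l, a ≠ 0) (he : ∀ a ∈ l, Even a) :
    contMatrix l 1 1 ≠ 0 ∧ contFrac l = (contMatrix l 0 1 : ℚ) / contMatrix l 1 1 := by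
  induction l with
  | nil => simp [contMatrix, contFrac]
  | cons b l ih =>
    obtain ⟨hq, hv⟩ := ih (fun a ha => h0 a (List.mem_cons_of_mem _ ha))
      (fun a ha => he a (List.mem_cons_of_mem _ ha))
    have hne := add_contFrac_ne_zero h0 he
    have hq' : (contMatrix l 1 1 : ℚ) ≠ 0 := by exact_mod_cast hq
    have e0 : contMatrix (b :: l) 0 1 = contMatrix l 1 1 := by
      rw [contMatrix_cons]; simp [Matrix.mul_apply, Fin.sum_univ_two]
    have e1 : contMatrix (b :: l) 1 1 = contMatrix l 0 1 + b * contMatrix l 1 1 := by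
      rw [contMatrix_cons]; simp [Matrix.mul_apply, Fin.sum_univ_two]
    rw [hv] at hne
    have e2 : (b : ℚ) + (contMatrix l 0 1 : ℚ) / contMatrix l 1 1 =
        (contMatrix (b :: l) 1 1 : ℚ) / contMatrix l 1 1 := by
      rw [e1]; push_cast; field_simp; ring
    refine ⟨fun h => hne (by rw [e2, h]; simp), ?_⟩
    rw [contFrac, hv, e2, e0, one_div_div]

/-- Modulo 2 every factor is the swap matrix, so the product is the swap or the identity according
to the length. The even corner in odd length is what gives a congruence modulo `2 q` rather than
only modulo `q`. -/
theorem even_contMatrix_diag {l : List ℤ} (he : ∀ a ∈ l, Even a) :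
    (Odd l.length → Even (contMatrix l 0 0)) ∧ (Even l.length → Even (contMatrix l 1 0)) := by
  induction l with
  | nil => simp [contMatrix]
  | cons b l ih =>
    obtain ⟨i1, i2⟩ := ih (fun a ha => he a (List.mem_cons_of_mem _ ha))
    have e0 : contMatrix (b :: l) 0 0 = contMatrix l 1 0 := by
      rw [contMatrix_cons]; simp [Matrix.mul_apply, Fin.sum_univ_two]
    have e1 : contMatrix (b :: l) 1 0 = contMatrix l 0 0 + b * contMatrix l 1 0 := by
      rw [contMatrix_cons]; simp [Matrix.mul_apply, Fin.sum_univ_two]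
    rw [List.length_cons, e0, e1]
    refine ⟨fun h => i2 ?_, fun h => (i1 ?_).add ((he b List.mem_cons_self).mul_right _)⟩
    · rwa [Nat.odd_add_one, Nat.not_odd_iff_even] at h
    · rwa [Nat.even_add_one, Nat.not_even_iff_odd] at h

theorem coprime_fraction_unique {p q P Q : ℤ} (hpq : IsCoprime p q) (hPQ : IsCoprime P Q)
    (h : p * Q = P * q) (hq : q ≠ 0) : ∃ ε : ℤ, (ε = 1 ∨ ε = -1) ∧ P = ε * p ∧ Q = ε * q := by
  have d1 : q ∣ Q := hpq.symm.dvd_of_dvd_mul_left (Dvd.intro_left P h.symm)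
  have d2 : Q ∣ q := hPQ.symm.dvd_of_dvd_mul_left (Dvd.intro_left p h)
  rcases Int.associated_iff.mp (associated_of_dvd_dvd d2 d1) with e | e
  · subst e
    exact ⟨1, Or.inl rfl, by linarith [mul_right_cancel₀ hq h], by ring⟩
  · have e' : Q = -q := by omega
    subst e'
    exact ⟨-1, Or.inr rfl, by
      have : (-p) * q = P * q := by linarith
      linarith [mul_right_cancel₀ hq this], by ring⟩

/-- The reversed expansion belongs to the inverse of the numerator modulo `2 q`. -/
theorem IsCanonicalExpansion.reverse {p pbar q : ℤ} {b : List ℤ}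
    (hb : IsCanonicalExpansion p q b) (hco : IsCoprime p q) (hltbar : |pbar| < |q|)
    (h : p * pbar ≡ 1 [ZMOD 2 * q]) : IsCanonicalExpansion pbar q b.reverse := by
  have hq : q ≠ 0 := by
    rintro rfl
    exact absurd hltbar (by simp)
  have r0 : ∀ a ∈ b.reverse, a ≠ 0 := fun a ha => hb.ne_zero a (List.mem_reverse.mp ha)
  have re : ∀ a ∈ b.reverse, Even a := fun a ha => hb.even a (List.mem_reverse.mp ha)
  refine ⟨r0, re, by simpa using hb.odd_length, ?_⟩
  obtain ⟨hQ, hv⟩ := contFrac_eq_div hb.ne_zero hb.even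
  obtain ⟨-, hv'⟩ := contFrac_eq_div r0 re
  have hlt := abs_contFrac_lt_one r0 re
  have hdet := det_contMatrix b
  rw [hb.odd_length.neg_one_pow, Matrix.det_fin_two] at hdet
  obtain ⟨c, hc⟩ := (even_contMatrix_diag hb.even).1 hb.odd_length
  rw [contMatrix_reverse] at hv'
  simp only [Matrix.transpose_apply] at hv'
  rw [hb.value] at hv
  generalize contMatrix b 0 0 = a at *
  generalize contMatrix b 0 1 = P at *
  generalize contMatrix b 1 0 = P' at *
  generalize contMatrix b 1 1 = Q at *
  have hqQ : (q : ℚ) ≠ 0 := by exact_mod_cast hq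
  have hQQ : (Q : ℚ) ≠ 0 := by exact_mod_cast hQ
  have hcross : p * Q = P * q := by
    rw [div_eq_div_iff hqQ hQQ] at hv
    exact_mod_cast hv
  -- The determinant reads `a Q - P P' = -1`, which is a Bézout identity for `P` and `Q`.
  have hPQ : IsCoprime P Q := ⟨P', -a, by linarith⟩
  obtain ⟨ε, hε, rfl, rfl⟩ := coprime_fraction_unique hco hPQ hcross hq
  have hεε : ε * ε = 1 := by rcases hε with rfl | rfl <;> norm_num
  rw [hv', abs_div, div_lt_one (abs_pos.mpr hQQ)] at hlt
  have hlt' : |P'| < |ε * q| := by exact_mod_cast hlt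
  have habs : |ε * q| = |q| := by rcases hε with rfl | rfl <;> simp
  have hP' : |ε * P'| = |P'| := by rcases hε with rfl | rfl <;> simp
  have hmod : p * (ε * P') ≡ 1 [ZMOD 2 * q] := by
    refine Int.ModEq.symm (Int.modEq_iff_dvd.mpr ⟨c * ε, ?_⟩)
    rw [hc] at hdet
    linear_combination -hdet
  have heq : ε * P' ≡ pbar [ZMOD 2 * q] := by
    have h1 : pbar * (p * (ε * P')) ≡ pbar * 1 [ZMOD 2 * q] := hmod.mul_left _
    have h2 : (p * pbar) * (ε * P') ≡ 1 * (ε * P') [ZMOD 2 * q] := h.mul_right _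
    rw [one_mul] at h2
    rw [mul_one] at h1
    refine h2.symm.trans ?_
    rwa [show p * pbar * (ε * P') = pbar * (p * (ε * P')) by ring]
  -- Two integers of absolute value below `|q|` that are congruent modulo `2 q` are equal.
  have hfin : pbar = ε * P' := by
    have hd := Int.modEq_iff_dvd.mp heq
    have : |pbar - ε * P'| < |2 * q| := by
      have := abs_sub pbar (ε * P')
      rw [abs_mul]; norm_num
      linarith
    linarith [Int.eq_zero_of_abs_lt_dvd ((abs_dvd _ _).mpr hd) this]
  rw [hv', hfin]
  push_cast
  rcases hε with rfl | rfl
  · simp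
  · simp [neg_div, div_neg]

theorem canonicalExpansion_unique {p q : ℤ} {b b' : List ℤ}
    (hb : IsCanonicalExpansion p q b) (hb' : IsCanonicalExpansion p q b') : b = b' :=
  contFrac_injective hb.ne_zero hb.even hb'.ne_zero hb'.even (hb.value.trans hb'.value.symm)

/-! ### Coordinates in space -/

/-- The coordinates of a point in the plane transverse to the first axis, as a complex number. -/
def cross (v : Space) : ℂ := ⟨v 1, v 2⟩

@[simp] theorem place_apply_zero (x : ℝ) (w : ℂ) : place x w 0 = x := by simp [place]

@[simp] theorem cross_place (x : ℝ) (w : ℂ) : cross (place x w) = w := by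
  apply Complex.ext <;> simp [cross, place]

@[simp] theorem place_cross (v : Space) : place (v 0) (cross v) = v := by
  ext i
  fin_cases i <;> simp [cross, place]

theorem norm_sq_eq (v : Space) : ‖v‖ ^ 2 = v 0 ^ 2 + Complex.normSq (cross v) := by
  rw [EuclideanSpace.norm_sq_eq, Fin.sum_univ_three, Complex.normSq_apply]
  simp only [cross, Real.norm_eq_abs, sq_abs]
  ring

section Smoothness

variable {E : Type*} [NormedAddCommGroup E] [NormedSpace ℝ E]

theorem ContDiffAt.place {f : E → ℝ} {g : E → ℂ} {u : E} (hf : ContDiffAt ℝ ∞ f u)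
    (hg : ContDiffAt ℝ ∞ g u) : ContDiffAt ℝ ∞ (fun t => place (f t) (g t)) u := by
  rw [contDiffAt_euclidean]
  intro i
  fin_cases i
  · exact hf
  · exact Complex.reCLM.contDiff.contDiffAt.comp u hg
  · exact Complex.imCLM.contDiff.contDiffAt.comp u hg

theorem ContDiff.place {f : E → ℝ} {g : E → ℂ} (hf : ContDiff ℝ ∞ f) (hg : ContDiff ℝ ∞ g) :
    ContDiff ℝ ∞ (fun t => place (f t) (g t)) :=
  contDiff_iff_contDiffAt.mpr fun _ => hf.contDiffAt.place hg.contDiffAt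

theorem contDiff_coord (i : Fin 3) : ContDiff ℝ ∞ (fun v : Space => v i) :=
  (EuclideanSpace.proj i : Space →L[ℝ] ℝ).contDiff

theorem contDiff_cross : ContDiff ℝ ∞ cross := by
  have h : cross = fun v : Space => (v 1 : ℂ) + (v 2 : ℂ) * Complex.I := by
    funext v
    apply Complex.ext <;> simp [cross]
  rw [h]
  exact (Complex.ofRealCLM.contDiff.comp (contDiff_coord 1)).add
    ((Complex.ofRealCLM.contDiff.comp (contDiff_coord 2)).mul contDiff_const)

theorem ContDiff.ofReal {f : E → ℝ} (hf : ContDiff ℝ ∞ f) :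
    ContDiff ℝ ∞ (fun t => (f t : ℂ)) := Complex.ofRealCLM.contDiff.comp hf

theorem ContDiff.re {f : E → ℂ} (hf : ContDiff ℝ ∞ f) :
    ContDiff ℝ ∞ (fun t => (f t).re) := Complex.reCLM.contDiff.comp hf

theorem ContDiff.normSq {f : E → ℂ} (hf : ContDiff ℝ ∞ f) :
    ContDiff ℝ ∞ (fun t => Complex.normSq (f t)) := by
  simp only [Complex.normSq_apply]
  exact (hf.re.mul hf.re).add
    ((Complex.imCLM.contDiff.comp hf).mul (Complex.imCLM.contDiff.comp hf))

end Smoothness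

theorem contDiff_smoothTransition : ContDiff ℝ ∞ Real.smoothTransition :=
  Real.smoothTransition.contDiff

/-! ### Diffeomorphisms isotopic to the identity -/

/-- A bijection of space that is smooth in both directions. -/
def IsDiffeo (e : Space ≃ Space) : Prop := ContDiff ℝ ∞ e ∧ ContDiff ℝ ∞ e.symm

/-- A smooth ambient isotopy leads from the identity to `e`. -/
def IsDiffeotopic (e : Space ≃ Space) : Prop :=
  ∃ F : ℝ → Space ≃ Space,
    ContDiff ℝ ∞ (fun u : ℝ × Space => F u.1 u.2) ∧
    ContDiff ℝ ∞ (fun u : ℝ × Space => (F u.1).symm u.2) ∧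
    (∀ x, F 0 x = x) ∧ ∀ x, F 1 x = e x

theorem IsDiffeo.trans {e f : Space ≃ Space} (he : IsDiffeo e) (hf : IsDiffeo f) :
    IsDiffeo (e.trans f) :=
  ⟨hf.1.comp he.1, he.2.comp hf.2⟩

theorem IsDiffeotopic.trans {e f : Space ≃ Space} (he : IsDiffeotopic e)
    (hf : IsDiffeotopic f) : IsDiffeotopic (e.trans f) := by
  obtain ⟨F, F1, F2, F3, F4⟩ := he
  obtain ⟨G, G1, G2, G3, G4⟩ := hf
  refine ⟨fun s => (F s).trans (G s), G1.comp (contDiff_fst.prodMk F1),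
    F2.comp (contDiff_fst.prodMk G2), fun x => ?_, fun x => ?_⟩
  · simp [F3, G3]
  · simp [F4, G4]

/-- Every stage of the isotopy is conjugated, so `k` itself need not be isotopic to the identity. -/
theorem IsDiffeotopic.conj {e k : Space ≃ Space} (he : IsDiffeotopic e) (hk : IsDiffeo k) :
    IsDiffeotopic ((k.trans e).trans k.symm) := by
  obtain ⟨F, F1, F2, F3, F4⟩ := he
  refine ⟨fun s => (k.trans (F s)).trans k.symm,
    hk.2.comp (F1.comp (contDiff_fst.prodMk (hk.1.comp contDiff_snd))),
    hk.2.comp (F2.comp (contDiff_fst.prodMk (hk.1.comp contDiff_snd))), fun x => ?_, fun x => ?_⟩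
  · simp [F3]
  · simp [F4]

/-- In a smooth family of diffeomorphisms all are isotopic to the identity if one of them is. -/
theorem IsDiffeotopic.of_family {G : ℝ → Space ≃ Space}
    (h1 : ContDiff ℝ ∞ (fun u : ℝ × Space => G u.1 u.2))
    (h2 : ContDiff ℝ ∞ (fun u : ℝ × Space => (G u.1).symm u.2)) (h0 : IsDiffeotopic (G 0)) :
    IsDiffeotopic (G 1) := by
  have s1 : ContDiff ℝ ∞ (G 0) := h1.comp (contDiff_const.prodMk contDiff_id)
  have s2 : ContDiff ℝ ∞ (G 0).symm := h2.comp (contDiff_const.prodMk contDiff_id)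
  -- Undoing `G 0` first turns the family into an isotopy that starts at the identity.
  have h : IsDiffeotopic ((G 0).symm.trans (G 1)) :=
    ⟨fun s => (G 0).symm.trans (G s), h1.comp (contDiff_fst.prodMk (s2.comp contDiff_snd)),
      s1.comp h2, fun x => by simp, fun x => rfl⟩
  have := h0.trans h
  rwa [← Equiv.trans_assoc, Equiv.self_trans_symm, Equiv.refl_trans] at this

theorem OrientedLink.isotopic_of_diffeotopic {k : ℕ} {L L' : OrientedLink k} {e : Space ≃ Space}
    (he : IsDiffeotopic e) (σ : Equiv.Perm (Fin k)) (c : ℝ)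
    (h : ∀ i t, e (L.curve i t) = L'.curve (σ i) (t + c)) : L.Isotopic L' := by
  obtain ⟨F, F1, F2, F3, F4⟩ := he
  refine ⟨F, F1, F2, F3, σ, fun _ t => t + c, fun i => ⟨by fun_prop, fun a b hab => ?_,
    fun t => by ring, fun t => ?_⟩⟩
  · simpa using hab
  · rw [F4, h]

/-! ### Half-turns about lines parallel to the second axis -/

/-- The rotation through `θ` about the second axis. -/
def turn (θ : ℝ) : Space ≃ Space where
  toFun v := place (Real.cos θ * v 0 - Real.sin θ * v 2) ⟨v 1, Real.sin θ * v 0 + Real.cos θ * v 2⟩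
  invFun v := place (Real.cos θ * v 0 + Real.sin θ * v 2) ⟨v 1, -Real.sin θ * v 0 + Real.cos θ * v 2⟩
  left_inv v := by
    have h := Real.sin_sq_add_cos_sq θ
    ext i
    fin_cases i
    · simp [place]
      linear_combination v 0 * h
    · simp [place]
    · simp [place]
      linear_combination v 2 * h
  right_inv v := by
    have h := Real.sin_sq_add_cos_sq θ
    ext i
    fin_cases i
    · simp [place]
      linear_combination v 0 * h
    · simp [place]
    · simp [place]
      linear_combination v 2 * h

theorem contDiff_mk {E : Type*} [NormedAddCommGroup E] [NormedSpace ℝ E] {f g : E → ℝ}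
    (hf : ContDiff ℝ ∞ f) (hg : ContDiff ℝ ∞ g) : ContDiff ℝ ∞ (fun t => (⟨f t, g t⟩ : ℂ)) := by
  have h : (fun t => (⟨f t, g t⟩ : ℂ)) = fun t => (f t : ℂ) + (g t : ℂ) * Complex.I := by
    funext v
    apply Complex.ext <;> simp
  rw [h]
  exact hf.ofReal.add (hg.ofReal.mul contDiff_const)

theorem isDiffeotopic_turn : IsDiffeotopic (turn Real.pi) := by
  have hs : ContDiff ℝ ∞ (fun u : ℝ × Space => Real.sin (Real.pi * u.1)) :=
    Real.contDiff_sin.comp (contDiff_const.mul contDiff_fst)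
  have hc : ContDiff ℝ ∞ (fun u : ℝ × Space => Real.cos (Real.pi * u.1)) :=
    Real.contDiff_cos.comp (contDiff_const.mul contDiff_fst)
  have hv (i : Fin 3) : ContDiff ℝ ∞ (fun u : ℝ × Space => u.2 i) :=
    (contDiff_coord i).comp contDiff_snd
  refine ⟨fun s => turn (Real.pi * s), ?_, ?_, fun x => ?_, fun x => by simp only [mul_one]⟩
  · exact ((hc.mul (hv 0)).sub (hs.mul (hv 2))).place
      (contDiff_mk (hv 1) ((hs.mul (hv 0)).add (hc.mul (hv 2))))
  · exact ((hc.mul (hv 0)).add (hs.mul (hv 2))).place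
      (contDiff_mk (hv 1) ((hs.neg.mul (hv 0)).add (hc.mul (hv 2))))
  · ext i
    fin_cases i <;> simp [turn, place]

theorem turn_pi_place (x : ℝ) (w : ℂ) :
    turn Real.pi (place x w) = place (-x) (starRingEnd ℂ w) := by
  ext i
  fin_cases i <;> simp [turn, place]

/-- The translation along the first axis. -/
def shift (c : ℝ) : Space ≃ Space where
  toFun v := place (v 0 + c) (cross v)
  invFun v := place (v 0 - c) (cross v)
  left_inv v := by simp
  right_inv v := by simp

theorem isDiffeo_shift (c : ℝ) : IsDiffeo (shift c) :=
  ⟨((contDiff_coord 0).add contDiff_const).place contDiff_cross,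
    ((contDiff_coord 0).sub contDiff_const).place contDiff_cross⟩

/-- The half-turn about the line `x 0 = c`, `x 2 = 0`. -/
def halfTurn (c : ℝ) : Space ≃ Space := ((shift (-c)).trans (turn Real.pi)).trans (shift (-c)).symm

theorem isDiffeotopic_halfTurn (c : ℝ) : IsDiffeotopic (halfTurn c) :=
  isDiffeotopic_turn.conj (isDiffeo_shift _)

theorem halfTurn_place (c x : ℝ) (w : ℂ) :
    halfTurn c (place x w) = place (2 * c - x) (starRingEnd ℂ w) := by
  have : halfTurn c (place x w) = (shift (-c)).symm (turn Real.pi (place (x + -c) w)) := by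
    simp [halfTurn, shift]
  rw [this, turn_pi_place]
  simp only [shift, Equiv.coe_fn_symm_mk, place_apply_zero, cross_place]
  congr 1
  ring

/-! ### The half-turn of a canonical link -/

/-- This symmetry of the twisting profile makes the half-turn carry one curve onto the other
exactly, with no further isotopy. -/
theorem smoothTransition_one_sub (x : ℝ) :
    Real.smoothTransition (1 - x) = 1 - Real.smoothTransition x := by
  have h := (Real.smoothTransition.pos_denom x).ne'
  unfold Real.smoothTransition
  rw [sub_sub_cancel, add_comm (expNegInvGlue (1 - x))]
  field_simp
  ring

theorem unitAt_add (a b : ℝ) : unitAt (a + b) = unitAt a * unitAt b := by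
  unfold unitAt
  rw [← Complex.exp_add]
  push_cast
  ring_nf

theorem conj_unitAt (a : ℝ) : starRingEnd ℂ (unitAt a) = unitAt (-a) := by
  unfold unitAt
  rw [← Complex.exp_conj]
  simp

theorem sum_get_reverse (b : List ℤ) (f : ℕ → ℤ → ℝ) :
    ∑ i : Fin b.reverse.length, f i (b.reverse.get i) =
      ∑ i : Fin b.length, f (b.length - 1 - i) (b.get i) := by
  have hl : b.reverse.length = b.length := List.length_reverse
  refine Fintype.sum_equiv ((finCongr hl).trans Fin.revPerm) _ _ fun i => ?_
  have hi : (i : ℕ) < b.length := lt_of_lt_of_eq i.2 hl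
  simp only [List.get_eq_getElem, Equiv.trans_apply, Fin.revPerm_apply, finCongr_apply,
    Fin.val_rev, Fin.val_cast, List.getElem_reverse]
  congr 1
  · omega
  · congr 1
    omega

/-- Measured from the right end, the angle is the total angle of the selected blocks minus the angle
measured from the left. The entries are even, so the total is a multiple of `2π` and drops out. The
hypothesis on `P` holds for the parity of the index because the number of blocks will be odd. -/
theorem unitAt_blocks_reverse {b : List ℤ} (hb : ∀ a ∈ b, Even a) (x : ℝ)
    (P : ℕ → Prop) [DecidablePred P] (hP : ∀ i < b.length, P (b.length - 1 - i) ↔ P i) :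
    unitAt (∑ i : Fin b.reverse.length, if P i then
        Real.pi * (b.reverse.get i : ℝ) * Real.smoothTransition (b.length - x - (i : ℕ)) else 0) =
      unitAt (-∑ i : Fin b.length, if P i then
        Real.pi * (b.get i : ℝ) * Real.smoothTransition (x - (i : ℕ)) else 0) := by
  have h := sum_get_reverse b (fun i a => if P i then
    Real.pi * (a : ℝ) * Real.smoothTransition (b.length - x - (i : ℕ)) else 0)
  rw [h]
  have h1 : unitAt (∑ i : Fin b.length, if P i then Real.pi * (b.get i : ℝ) else 0) = 1 := by
    refine unitAt_sum _ _ fun i _ => ?_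
    split_ifs
    · exact unitAt_of_even (hb _ (List.get_mem b i))
    · exact unitAt_zero
  rw [← one_mul (unitAt (-_)), ← h1, ← unitAt_add, ← Finset.sum_neg_distrib,
    ← Finset.sum_add_distrib]
  congr 1
  refine Finset.sum_congr rfl fun i _ => ?_
  have hc : ((b.length - 1 - (i : ℕ) : ℕ) : ℝ) = b.length - 1 - (i : ℕ) := by
    have := i.2
    rw [Nat.sub_sub, Nat.cast_sub (by omega)]
    push_cast
    ring
  by_cases hi : P i
  · rw [if_pos ((hP i i.2).mpr hi), if_pos hi, if_pos hi, hc,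
      show (b.length : ℝ) - x - (b.length - 1 - (i : ℕ)) = 1 - (x - (i : ℕ)) by ring,
      smoothTransition_one_sub]
    ring
  · rw [if_neg (fun h => hi ((hP i i.2).mp h)), if_neg hi, if_neg hi]
    simp

theorem unitAt_middle_reverse {b : List ℤ} (hb : ∀ a ∈ b, Even a) (hn : Odd b.length) (x : ℝ) :
    unitAt (middleAngle b.reverse (b.length - x)) = starRingEnd ℂ (unitAt (middleAngle b x)) := by
  rw [conj_unitAt]
  refine unitAt_blocks_reverse hb x Even fun i hi => ?_
  obtain ⟨m, hm⟩ := hn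
  rw [Nat.even_iff, Nat.even_iff]
  omega

theorem upperAngle_eq (b : List ℤ) (x : ℝ) :
    upperAngle b x = -∑ i : Fin b.length, if ¬ Even (i : ℕ) then
      Real.pi * (b.get i : ℝ) * Real.smoothTransition (x - (i : ℕ)) else 0 := by
  unfold upperAngle
  rw [← Finset.sum_neg_distrib]
  refine Finset.sum_congr rfl fun i _ => ?_
  by_cases h : Even (i : ℕ) <;> simp [h]

theorem unitAt_upper_reverse {b : List ℤ} (hb : ∀ a ∈ b, Even a) (hn : Odd b.length) (x : ℝ) :
    unitAt (upperAngle b.reverse (b.length - x)) = starRingEnd ℂ (unitAt (upperAngle b x)) := by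
  rw [upperAngle_eq, upperAngle_eq, ← conj_unitAt]
  refine congrArg _ (unitAt_blocks_reverse hb x (fun i => ¬ Even i) fun i hi => ?_)
  obtain ⟨m, hm⟩ := hn
  rw [Nat.even_iff, Nat.even_iff]
  omega

theorem axial_pi_sub (n : ℕ) (t : ℝ) : axial n (Real.pi - t) = n - axial n t := by
  simp only [axial, Real.cos_pi_sub]
  ring

/-- A half-turn reverses the word, and also the orientation of both components. -/
theorem halfTurn_canonicalCurve {b : List ℤ} (hb : ∀ a ∈ b, Even a) (hn : Odd b.length)
    (k : Fin 2) (t : ℝ) :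
    halfTurn (b.length / 2) (canonicalCurve b k t) =
      canonicalCurve b.reverse k (Real.pi - t) := by
  unfold canonicalCurve
  rw [halfTurn_place, List.length_reverse, axial_pi_sub]
  congr 1
  · ring
  · unfold upperPoint lowerPoint
    rw [List.length_reverse, axial_pi_sub, Real.sin_pi_sub, unitAt_middle_reverse hb hn,
      unitAt_upper_reverse hb hn]
    split_ifs <;> simp [-Complex.ofReal_sin, map_ofNat]

/-! ### A diffeomorphism that bends planes into spheres -/

/-- A bijection with smooth direct map is a diffeomorphism if all its derivatives are injective. -/
theorem isDiffeo_of_injective_fderiv {e : Space ≃ Space} (he : ContDiff ℝ ∞ e)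
    (h : ∀ v u, fderiv ℝ e v u = 0 → u = 0) : IsDiffeo e := by
  refine ⟨he, contDiff_iff_contDiffAt.mpr fun y => ?_⟩
  obtain ⟨v, rfl⟩ := e.surjective y
  have hinj : Function.Injective (fderiv ℝ e v : Space →ₗ[ℝ] Space) := by
    refine (injective_iff_map_eq_zero _).mpr fun u hu => h v u hu
  let f' : Space ≃L[ℝ] Space := (LinearEquiv.ofInjectiveEndo _ hinj).toContinuousLinearEquiv
  have hf' : HasFDerivAt e (f' : Space →L[ℝ] Space) v := by
    have : (f' : Space →L[ℝ] Space) = fderiv ℝ e v := by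
      ext u
      rfl
    rw [this]
    exact (he.differentiable (by simp)).differentiableAt.hasFDerivAt
  have hs : HasStrictFDerivAt e (f' : Space →L[ℝ] Space) v :=
    he.contDiffAt.hasStrictFDerivAt' hf' (by simp)
  -- The inverse function theorem gives a smooth local inverse; being a right inverse of the
  -- bijection `e`, it agrees with `e.symm` near `e v`.
  have hl := ContDiffAt.to_localInverse he.contDiffAt hf' (by simp)
  refine hl.congr_of_eventuallyEq ?_
  filter_upwards [hs.eventually_right_inverse] with z hz
  rw [Equiv.symm_apply_eq]
  exact hz.symm

/-- A smooth monotone function with `clamp x = x` for `2 ≤ x` and values at least `1`. -/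
def clamp (x : ℝ) : ℝ := 1 + Real.smoothTransition (x - 1) * (x - 1)

theorem contDiff_clamp : ContDiff ℝ ∞ clamp :=
  contDiff_const.add ((contDiff_smoothTransition.comp (contDiff_id.sub contDiff_const)).mul
    (contDiff_id.sub contDiff_const))

theorem clamp_of_two_le {x : ℝ} (hx : 2 ≤ x) : clamp x = x := by
  rw [clamp, Real.smoothTransition.one_of_one_le (by linarith)]
  ring

theorem one_le_clamp (x : ℝ) : 1 ≤ clamp x := by
  unfold clamp
  rcases le_total x 1 with h | h
  · rw [Real.smoothTransition.zero_of_nonpos (by linarith)]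
    linarith
  · have := mul_nonneg (Real.smoothTransition.nonneg (x - 1)) (sub_nonneg.mpr h)
    linarith

theorem clamp_pos (x : ℝ) : 0 < clamp x := zero_lt_one.trans_le (one_le_clamp x)

theorem monotone_clamp : Monotone clamp := by
  intro x y hxy
  rcases le_total x 1 with h | h
  · have : clamp x = 1 := by
      rw [clamp, Real.smoothTransition.zero_of_nonpos (by linarith)]
      ring
    rw [this]
    exact one_le_clamp y
  · unfold clamp
    have := mul_le_mul (Real.smoothTransition.monotone (sub_le_sub_right hxy 1))
      (sub_le_sub_right hxy 1) (sub_nonneg.mpr h) (Real.smoothTransition.nonneg _)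
    linarith

/-- For fixed distance from the axis, with square `u`, the new first coordinate. -/
def bend (u x : ℝ) : ℝ := (x - u / clamp x) / 2

/-- The term `-u / clamp x` is nondecreasing in `x`, which leaves a slope of at least 1/2. Where
`clamp x = x`, the equation `bend u x = X` means `x = X + √(X² + u)`, that is, radius plus first
coordinate; `clamp` extends this to a bijection of the whole line. -/
theorem half_sub_le_bend_sub {u x y : ℝ} (hu : 0 ≤ u) (hxy : x ≤ y) :
    (y - x) / 2 ≤ bend u y - bend u x := by
  have := div_le_div_of_nonneg_left hu (clamp_pos x) (monotone_clamp hxy)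
  unfold bend
  linarith

theorem strictMono_bend {u : ℝ} (hu : 0 ≤ u) : StrictMono (bend u) := by
  intro x y hxy
  have := half_sub_le_bend_sub hu hxy.le
  linarith

theorem continuous_bend (u : ℝ) : Continuous (bend u) :=
  (continuous_id.sub (continuous_const.div contDiff_clamp.continuous
    fun x => (clamp_pos x).ne')).div_const 2

theorem surjective_bend {u : ℝ} (hu : 0 ≤ u) : Function.Surjective (bend u) := by
  intro y
  have h1 : bend u (2 * y) ≤ y := by
    have := div_nonneg hu (clamp_pos (2 * y)).le
    unfold bend
    linarith
  have h2 : y ≤ bend u (2 * y + u) := by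
    have := div_le_self hu (one_le_clamp (2 * y + u))
    unfold bend
    linarith
  obtain ⟨x, -, hx⟩ := intermediate_value_Icc (by linarith) (continuous_bend u).continuousOn ⟨h1, h2⟩
  exact ⟨x, hx⟩

/-- The bijection `bend u`. -/
def bendEquiv (w : ℂ) : ℝ ≃ ℝ :=
  Equiv.ofBijective (bend (Complex.normSq w))
    ⟨(strictMono_bend (Complex.normSq_nonneg w)).injective,
      surjective_bend (Complex.normSq_nonneg w)⟩

/-- Bending of the planes `x 0 = const` along the first axis. -/
def bendSpace : Space ≃ Space where
  toFun v := place (bendEquiv (cross v) (v 0)) (cross v)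
  invFun v := place ((bendEquiv (cross v)).symm (v 0)) (cross v)
  left_inv v := by simp
  right_inv v := by simp

theorem bendSpace_apply (v : Space) :
    bendSpace v = place (bend (Complex.normSq (cross v)) (v 0)) (cross v) := rfl

theorem contDiff_bendSpace : ContDiff ℝ ∞ bendSpace := by
  have : (bendSpace : Space → Space) =
      fun v => place ((v 0 - Complex.normSq (cross v) / clamp (v 0)) / 2) (cross v) := by
    funext v
    exact bendSpace_apply v
  rw [this]
  exact (((contDiff_coord 0).sub (contDiff_cross.normSq.div
    (contDiff_clamp.comp (contDiff_coord 0)) fun v => (clamp_pos _).ne')).div_const 2).place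
      contDiff_cross

/-- A vector killed by the derivative has no transverse components, since those coordinates are
preserved. Its axial component vanishes because `bend` has slope at least 1/2. -/
theorem isDiffeo_bendSpace : IsDiffeo bendSpace := by
  refine isDiffeo_of_injective_fderiv contDiff_bendSpace fun v u hu => ?_
  have hd : HasDerivAt (fun t : ℝ => bendSpace (v + t • u)) 0 0 := by
    have h1 : HasFDerivAt bendSpace (fderiv ℝ bendSpace v) (v + (0 : ℝ) • u) := by
      rw [zero_smul, add_zero]
      exact (contDiff_bendSpace.differentiable (by simp)).differentiableAt.hasFDerivAt
    have h2 : HasDerivAt (fun t : ℝ => v + t • u) u 0 := by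
      simpa using ((hasDerivAt_id (0 : ℝ)).smul_const u).const_add v
    have := h1.comp_hasDerivAt (0 : ℝ) h2
    rwa [hu] at this
  have hcoord (i : Fin 3) : HasDerivAt (fun t : ℝ => bendSpace (v + t • u) i) 0 0 := by
    have := (EuclideanSpace.proj i : Space →L[ℝ] ℝ).hasFDerivAt.comp_hasDerivAt (0 : ℝ) hd
    rwa [map_zero] at this
  have hlin (i : Fin 3) : HasDerivAt (fun t : ℝ => v i + t * u i) (u i) 0 := by
    simpa using ((hasDerivAt_id (0 : ℝ)).mul_const (u i)).const_add (v i)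
  have h1 : u 1 = 0 := by
    refine (hlin 1).unique ?_
    have e : (fun t : ℝ => v 1 + t * u 1) = fun t => bendSpace (v + t • u) 1 := by
      funext t
      simp [bendSpace_apply, place, cross]
    rw [e]
    exact hcoord 1
  have h2 : u 2 = 0 := by
    refine (hlin 2).unique ?_
    have e : (fun t : ℝ => v 2 + t * u 2) = fun t => bendSpace (v + t • u) 2 := by
      funext t
      simp [bendSpace_apply, place, cross]
    rw [e]
    exact hcoord 2
  have hcr (t : ℝ) : cross (v + t • u) = cross v := by
    apply Complex.ext <;> simp [cross, h1, h2]
  have h0 : HasDerivAt (fun t : ℝ => bend (Complex.normSq (cross v)) (v 0 + t * u 0)) 0 0 := by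
    have e : (fun t : ℝ => bend (Complex.normSq (cross v)) (v 0 + t * u 0)) =
        fun t => bendSpace (v + t • u) 0 := by
      funext t
      simp [bendSpace_apply, hcr]
    rw [e]
    exact hcoord 0
  have key : u 0 = 0 := by
    by_contra hne
    set g := fun t : ℝ => bend (Complex.normSq (cross v)) (v 0 + t * u 0) with hg
    have hb : ∀ t : ℝ, |u 0| / 2 * |t - 0| ≤ |g t - g 0| := by
      intro t
      have hnn := Complex.normSq_nonneg (cross v)
      have e : |u 0| / 2 * |t - 0| = |t * u 0| / 2 := by rw [abs_mul, sub_zero]; ring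
      rw [e, hg]
      simp only [zero_mul, add_zero]
      rcases le_total 0 (t * u 0) with h | h
      · have := half_sub_le_bend_sub hnn (show v 0 ≤ v 0 + t * u 0 by linarith)
        rw [abs_of_nonneg h]
        refine le_trans ?_ (le_abs_self _)
        linarith
      · have := half_sub_le_bend_sub hnn (show v 0 + t * u 0 ≤ v 0 by linarith)
        rw [abs_of_nonpos h]
        refine le_trans ?_ (neg_le_abs _)
        linarith
    have hz := h0.isLittleO.def (show 0 < |u 0| / 4 by positivity)
    obtain ⟨ε, hε, hball⟩ := Metric.eventually_nhds_iff.mp hz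
    have hd : dist (ε / 2) 0 < ε := by
      rw [Real.dist_eq, sub_zero, abs_of_pos (by positivity)]
      linarith
    have h3 := hball hd
    have h4 := hb (ε / 2)
    simp only [smul_zero, sub_zero, Real.norm_eq_abs] at h3 h4
    have : 0 < |u 0| * |ε / 2| := by positivity
    linarith
  ext i
  fin_cases i
  · exact key
  · exact h1
  · exact h2

/-- Multiplication of the planes `x 0 = const` by positive numbers. -/
def widen : Space ≃ Space where
  toFun v := place (v 0) (clamp (v 0) * cross v)
  invFun v := place (v 0) (cross v / clamp (v 0))
  left_inv v := by
    have : (clamp (v 0) : ℂ) ≠ 0 := by exact_mod_cast (clamp_pos (v 0)).ne'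
    simp [mul_div_cancel_left₀ _ this]
  right_inv v := by
    have : (clamp (v 0) : ℂ) ≠ 0 := by exact_mod_cast (clamp_pos (v 0)).ne'
    simp [mul_div_cancel₀ _ this]

theorem isDiffeo_widen : IsDiffeo widen := by
  have h : ContDiff ℝ ∞ (fun v : Space => (clamp (v 0) : ℂ)) :=
    (contDiff_clamp.comp (contDiff_coord 0)).ofReal
  have h' : ∀ v : Space, (clamp (v 0) : ℂ) ≠ 0 := fun v => by
    exact_mod_cast (clamp_pos (v 0)).ne'
  refine ⟨(contDiff_coord 0).place (h.mul contDiff_cross), (contDiff_coord 0).place ?_⟩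
  simp only [div_eq_mul_inv]
  exact contDiff_cross.mul (h.inv h')

/-- The bijection `(x, w) ↦ (2 x / (1 + |w|²), w)`. -/
def stretch : Space ≃ Space where
  toFun v := place (2 * v 0 / (1 + Complex.normSq (cross v))) (cross v)
  invFun v := place (v 0 * (1 + Complex.normSq (cross v)) / 2) (cross v)
  left_inv v := by
    have : 1 + Complex.normSq (cross v) ≠ 0 := by
      have := Complex.normSq_nonneg (cross v)
      positivity
    simp only [place_apply_zero, cross_place]
    field_simp
    simp
  right_inv v := by
    have : 1 + Complex.normSq (cross v) ≠ 0 := by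
      have := Complex.normSq_nonneg (cross v)
      positivity
    simp only [place_apply_zero, cross_place]
    field_simp
    simp

theorem isDiffeo_stretch : IsDiffeo stretch := by
  have h : ContDiff ℝ ∞ (fun v : Space => 1 + Complex.normSq (cross v)) :=
    contDiff_const.add contDiff_cross.normSq
  exact ⟨((contDiff_const.mul (contDiff_coord 0)).div h fun v => by
    have := Complex.normSq_nonneg (cross v)
    positivity).place contDiff_cross,
    (((contDiff_coord 0).mul h).div_const 2).place contDiff_cross⟩

/-- The point with stereographic coordinate `w` on the sphere of radius `R` about the origin. -/
def spherePoint (R : ℝ) (w : ℂ) : Space :=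
  place (R * (1 - Complex.normSq w) / (1 + Complex.normSq w))
    ((2 * R / (1 + Complex.normSq w) : ℝ) * w)

/-- A diffeomorphism that maps large parts of the planes `x 0 = const` to concentric spheres. -/
def spherify : Space ≃ Space := (((shift 11).trans stretch).trans widen).trans bendSpace

theorem isDiffeo_spherify : IsDiffeo spherify :=
  (((isDiffeo_shift 11).trans isDiffeo_stretch).trans isDiffeo_widen).trans isDiffeo_bendSpace

/-- Let `(X, W)` be the point with stereographic coordinate `w` on the sphere of radius `R = x +
11`. The maps before `bendSpace` produce `(R + X, W)`, and `bendSpace` turns `R + X` into `X`. -/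
theorem spherify_place {x : ℝ} {w : ℂ} (hx : -1 ≤ x) (hw : ‖w‖ ≤ 3) :
    spherify (place x w) = spherePoint (x + 11) w := by
  have hn := Complex.normSq_nonneg w
  have hn9 : Complex.normSq w ≤ 9 := by
    rw [Complex.normSq_eq_norm_sq]
    nlinarith [norm_nonneg w]
  -- The shift 11 is chosen for this bound: `x + 11 ≥ 10` and `1 + |w|² ≤ 10`, so `clamp` acts as
  -- the identity.
  have h2 : 2 ≤ 2 * (x + 11) / (1 + Complex.normSq w) := by
    rw [le_div_iff₀ (by positivity)]
    linarith
  have e : spherify (place x w) = bendSpace (place (2 * (x + 11) / (1 + Complex.normSq w))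
      (clamp (2 * (x + 11) / (1 + Complex.normSq w)) * w)) := by
    simp [spherify, shift, stretch, widen]
  rw [e, bendSpace_apply, clamp_of_two_le h2]
  simp only [place_apply_zero, cross_place, bend, spherePoint, clamp_of_two_le h2,
    Complex.normSq_mul, Complex.normSq_ofReal]
  congr 1
  have : x + 11 ≠ 0 := by linarith
  have : 1 + Complex.normSq w ≠ 0 := by positivity
  field_simp

/-! ### Möbius involutions of concentric spheres

The point `(X, W)` of the sphere of radius `R` corresponds to the Hermitian matrix with diagonal
entries `R - X` and `R + X` and corner `W`; its stereographic coordinate is `W / (R + X)`. The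
involution `w ↦ (k - E w) / (w + E)` acts on such matrices `N` by `N ↦ M N M*` with
`M = !![-E, k; 1, E]`. -/

section Hermitian

variable (E k : ℂ) (A B : ℝ) (W : ℂ)

/-- The first diagonal entry of `M N M*`. -/
def hermFst : ℝ :=
  Complex.normSq E * A - 2 * (E * starRingEnd ℂ k * W).re + Complex.normSq k * B

/-- The second diagonal entry of `M N M*`. -/
def hermSnd : ℝ := A + 2 * (W * starRingEnd ℂ E).re + Complex.normSq E * B

/-- The corner of `M N M*`. -/
def hermCorner : ℂ :=
  -E * A - Complex.normSq E * W + k * starRingEnd ℂ W + k * starRingEnd ℂ E * B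

/-- The matrix `M` has trace zero and `M²` is the scalar `E² + k`, so acting twice multiplies `N` by
`|E² + k|²`. This identity is checked entry by entry here and in the next two lemmas. -/
theorem hermFst_hermFst :
    hermFst E k (hermFst E k A B W) (hermSnd E A B W) (hermCorner E k A B W) =
      Complex.normSq (E ^ 2 + k) * A := by
  simp [hermFst, hermSnd, hermCorner, Complex.normSq_apply, pow_two]
  ring

theorem hermSnd_hermSnd :
    hermSnd E (hermFst E k A B W) (hermSnd E A B W) (hermCorner E k A B W) =
      Complex.normSq (E ^ 2 + k) * B := by
  simp [hermFst, hermSnd, hermCorner, Complex.normSq_apply, pow_two]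
  ring

theorem hermCorner_hermCorner :
    hermCorner E k (hermFst E k A B W) (hermSnd E A B W) (hermCorner E k A B W) =
      Complex.normSq (E ^ 2 + k) * W := by
  apply Complex.ext <;>
  · simp [hermFst, hermSnd, hermCorner, Complex.normSq_apply, pow_two]
    ring

/-- Since `det M = -(E² + k)`, determinants are multiplied by `|E² + k|²`; a zero determinant, which
characterises points of the sphere, stays zero. -/
theorem herm_det (h : A * B = Complex.normSq W) :
    hermFst E k A B W * hermSnd E A B W = Complex.normSq (hermCorner E k A B W) := by
  have e : hermFst E k A B W * hermSnd E A B W - Complex.normSq (hermCorner E k A B W) =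
      Complex.normSq (E ^ 2 + k) * (A * B - Complex.normSq W) := by
    simp [hermFst, hermSnd, hermCorner, Complex.normSq_apply, pow_two]
    ring
  rw [h, sub_self, mul_zero] at e
  linarith

theorem herm_smul (c : ℝ) :
    hermFst E k (c * A) (c * B) (c * W) = c * hermFst E k A B W ∧
    hermSnd E (c * A) (c * B) (c * W) = c * hermSnd E A B W ∧
    hermCorner E k (c * A) (c * B) (c * W) = c * hermCorner E k A B W := by
  refine ⟨?_, ?_, ?_⟩
  · simp [hermFst]
    ring
  · simp [hermSnd]
    ring
  · simp [hermCorner]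
    ring

variable {E k A B W}

/-- For `B > 0` one has `N = v v* / B` with `v = (W, B)`, so the new trace is `|M v|² / B`, and `M`
is invertible. For `B = 0` the corner vanishes and the trace is `(|E|² + 1) A`. -/
theorem herm_trace_pos (hk : E ^ 2 + k ≠ 0) (hA : 0 ≤ A) (hB : 0 ≤ B) (hAB : 0 < A + B)
    (h : A * B = Complex.normSq W) : 0 < hermFst E k A B W + hermSnd E A B W := by
  rcases hB.eq_or_lt with rfl | hB
  · have hW : W = 0 := Complex.normSq_eq_zero.mp (by rw [← h, mul_zero])
    subst hW
    have := Complex.normSq_nonneg E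
    simp only [hermFst, hermSnd, mul_zero, zero_mul, Complex.zero_re, sub_zero, add_zero]
    nlinarith
  · have e : B * (hermFst E k A B W + hermSnd E A B W) =
        Complex.normSq (W + E * B) + Complex.normSq (k * B - E * W) := by
      have : B * (hermFst E k A B W + hermSnd E A B W) =
          (Complex.normSq E + 1) * (A * B - Complex.normSq W) +
            (Complex.normSq (W + E * B) + Complex.normSq (k * B - E * W)) := by
        simp [hermFst, hermSnd, Complex.normSq_apply]
        ring
      rw [this, h]
      ring
    refine pos_of_mul_pos_right (a := B) ?_ hB.le
    rw [e]
    have n1 := Complex.normSq_nonneg (W + E * B)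
    have n2 := Complex.normSq_nonneg (k * B - E * W)
    refine lt_of_le_of_ne (by linarith) fun h0 => hk ?_
    have z1 := Complex.normSq_eq_zero.mp (show Complex.normSq (W + E * B) = 0 by linarith)
    have z2 := Complex.normSq_eq_zero.mp (show Complex.normSq (k * B - E * W) = 0 by linarith)
    have hB' : (B : ℂ) ≠ 0 := by exact_mod_cast hB.ne'
    have : (E ^ 2 + k) * B = 0 := by linear_combination z2 + E * z1
    exact (mul_eq_zero.mp this).resolve_right hB'

end Hermitian

/-- The Möbius involution with parameters `E`, `k` on the sphere about the origin through `v`. -/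
def sphereInvolution (E k : ℂ) (v : Space) : Space :=
  place (‖v‖ * (hermSnd E (‖v‖ - v 0) (‖v‖ + v 0) (cross v) -
      hermFst E k (‖v‖ - v 0) (‖v‖ + v 0) (cross v)) /
        (hermFst E k (‖v‖ - v 0) (‖v‖ + v 0) (cross v) +
          hermSnd E (‖v‖ - v 0) (‖v‖ + v 0) (cross v)))
    ((2 * ‖v‖ / (hermFst E k (‖v‖ - v 0) (‖v‖ + v 0) (cross v) +
          hermSnd E (‖v‖ - v 0) (‖v‖ + v 0) (cross v)) : ℝ) *
      hermCorner E k (‖v‖ - v 0) (‖v‖ + v 0) (cross v))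

theorem norm_sub_mul_norm_add (v : Space) :
    (‖v‖ - v 0) * (‖v‖ + v 0) = Complex.normSq (cross v) := by
  have := norm_sq_eq v
  linear_combination this

theorem abs_coord_le_norm (v : Space) : |v 0| ≤ ‖v‖ := by
  refine abs_le_of_sq_le_sq ?_ (norm_nonneg v)
  have := Complex.normSq_nonneg (cross v)
  rw [norm_sq_eq]
  linarith

theorem herm_trace_pos_of_ne_zero {E k : ℂ} (hk : E ^ 2 + k ≠ 0) {v : Space} (hv : v ≠ 0) :
    0 < hermFst E k (‖v‖ - v 0) (‖v‖ + v 0) (cross v) +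
      hermSnd E (‖v‖ - v 0) (‖v‖ + v 0) (cross v) := by
  have h := abs_le.mp (abs_coord_le_norm v)
  have hp := norm_pos_iff.mpr hv
  exact herm_trace_pos hk (by linarith) (by linarith) (by linarith) (norm_sub_mul_norm_add v)

theorem sphereInvolution_zero (E k : ℂ) : sphereInvolution E k 0 = 0 := by
  ext i
  fin_cases i <;> simp [sphereInvolution, place]

theorem norm_sphereInvolution {E k : ℂ} (hk : E ^ 2 + k ≠ 0) (v : Space) :
    ‖sphereInvolution E k v‖ = ‖v‖ := by
  by_cases hv : v = 0
  · rw [hv, sphereInvolution_zero]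
  have hT := herm_trace_pos_of_ne_zero hk hv
  have hdet := herm_det E k _ _ _ (norm_sub_mul_norm_add v)
  rw [← sq_eq_sq₀ (norm_nonneg _) (norm_nonneg _), norm_sq_eq (sphereInvolution E k v)]
  simp only [sphereInvolution, place_apply_zero, cross_place, Complex.normSq_mul,
    Complex.normSq_ofReal, ← hdet]
  have := hT.ne'
  field_simp
  ring

/-- Two applications multiply the Hermitian matrix by a positive scalar, which the normalisation of
the trace to `2 ‖v‖` removes. `herm_smul` carries the first normalising factor through the second
application. -/
theorem sphereInvolution_involutive {E k : ℂ} (hk : E ^ 2 + k ≠ 0) :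
    Function.Involutive (sphereInvolution E k) := by
  intro v
  by_cases hv : v = 0
  · rw [hv, sphereInvolution_zero, sphereInvolution_zero]
  have hT := herm_trace_pos_of_ne_zero hk hv
  have hR := norm_pos_iff.mpr hv
  have hD : 0 < Complex.normSq (E ^ 2 + k) := Complex.normSq_pos.mpr hk
  have hn := norm_sphereInvolution hk v
  have q1 := hermFst_hermFst E k (‖v‖ - v 0) (‖v‖ + v 0) (cross v)
  have q2 := hermSnd_hermSnd E k (‖v‖ - v 0) (‖v‖ + v 0) (cross v)
  have q3 := hermCorner_hermCorner E k (‖v‖ - v 0) (‖v‖ + v 0) (cross v)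
  have hs := fun c => herm_smul E k (hermFst E k (‖v‖ - v 0) (‖v‖ + v 0) (cross v))
    (hermSnd E (‖v‖ - v 0) (‖v‖ + v 0) (cross v))
    (hermCorner E k (‖v‖ - v 0) (‖v‖ + v 0) (cross v)) c
  have e0 : sphereInvolution E k v 0 = ‖v‖ *
      (hermSnd E (‖v‖ - v 0) (‖v‖ + v 0) (cross v) -
        hermFst E k (‖v‖ - v 0) (‖v‖ + v 0) (cross v)) /
        (hermFst E k (‖v‖ - v 0) (‖v‖ + v 0) (cross v) +
          hermSnd E (‖v‖ - v 0) (‖v‖ + v 0) (cross v)) := by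
    simp [sphereInvolution]
  have ec : cross (sphereInvolution E k v) =
      ((2 * ‖v‖ / (hermFst E k (‖v‖ - v 0) (‖v‖ + v 0) (cross v) +
          hermSnd E (‖v‖ - v 0) (‖v‖ + v 0) (cross v)) : ℝ) *
      hermCorner E k (‖v‖ - v 0) (‖v‖ + v 0) (cross v)) := by
    simp only [sphereInvolution, cross_place]
  rw [sphereInvolution, hn, e0, ec]
  generalize hermFst E k (‖v‖ - v 0) (‖v‖ + v 0) (cross v) = P at *
  generalize hermSnd E (‖v‖ - v 0) (‖v‖ + v 0) (cross v) = Q at *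
  generalize hermCorner E k (‖v‖ - v 0) (‖v‖ + v 0) (cross v) = C at *
  have hT' := hT.ne'
  obtain ⟨s1, s2, s3⟩ := hs (2 * ‖v‖ / (P + Q))
  have f1 : ‖v‖ - ‖v‖ * (Q - P) / (P + Q) = 2 * ‖v‖ / (P + Q) * P := by
    field_simp
    ring
  have f2 : ‖v‖ + ‖v‖ * (Q - P) / (P + Q) = 2 * ‖v‖ / (P + Q) * Q := by
    field_simp
    ring
  rw [f1, f2, s1, s2, s3, q1, q2, q3]
  have hR' := hR.ne'
  have hD' := hD.ne'
  set c := 2 * ‖v‖ / (P + Q) with hc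
  have hc0 : c ≠ 0 := by rw [hc]; positivity
  have g : c * (Complex.normSq (E ^ 2 + k) * (‖v‖ - v 0)) +
      c * (Complex.normSq (E ^ 2 + k) * (‖v‖ + v 0)) =
        2 * c * Complex.normSq (E ^ 2 + k) * ‖v‖ := by ring
  rw [g]
  conv_rhs => rw [← place_cross v]
  congr 1
  · field_simp
    ring
  · rw [← mul_assoc, ← mul_assoc, ← Complex.ofReal_mul, ← Complex.ofReal_mul]
    convert one_mul (cross v) using 2
    rw [← Complex.ofReal_one]
    congr 1
    field_simp

theorem norm_spherePoint {R : ℝ} (hR : 0 ≤ R) (w : ℂ) : ‖spherePoint R w‖ = R := by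
  have hn := Complex.normSq_nonneg w
  have : 1 + Complex.normSq w ≠ 0 := by positivity
  rw [← sq_eq_sq₀ (norm_nonneg _) hR, norm_sq_eq]
  simp only [spherePoint, place_apply_zero, cross_place, Complex.normSq_mul,
    Complex.normSq_ofReal]
  field_simp
  ring

theorem sphereInvolution_spherePoint {E k w w' : ℂ} {R : ℝ} (hR : 0 < R) (hk : E ^ 2 + k ≠ 0)
    (h : w * w' + E * (w + w') = k) :
    sphereInvolution E k (spherePoint R w) = spherePoint R w' := by
  have hn := Complex.normSq_nonneg w
  have hn' := Complex.normSq_nonneg w'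
  have h1 : 1 + Complex.normSq w ≠ 0 := by positivity
  have h1' : 1 + Complex.normSq w' ≠ 0 := by positivity
  -- At `w = -E` the relation `h` reads `k = -E²`, the excluded degenerate case.
  have hE : w + E ≠ 0 := by
    intro h0
    have : E = -w := by linear_combination h0
    subst this
    exact hk (by linear_combination -h)
  have hE' : Complex.normSq (w + E) ≠ 0 := (Complex.normSq_pos.mpr hE).ne'
  set c : ℝ := 2 * R / (1 + Complex.normSq w) with hc
  have hc0 : c ≠ 0 := by rw [hc]; positivity
  have a0 : R - spherePoint R w 0 = c * Complex.normSq w := by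
    rw [spherePoint, place_apply_zero, hc]
    field_simp
    ring
  have b0 : R + spherePoint R w 0 = c * 1 := by
    rw [spherePoint, place_apply_zero, hc]
    field_simp
    ring
  have w0 : cross (spherePoint R w) = c * w := by
    rw [spherePoint, cross_place]
  obtain ⟨s1, s2, s3⟩ := herm_smul E k (Complex.normSq w) 1 w c
  have t1 : hermFst E k (Complex.normSq w) 1 w = Complex.normSq (w + E) * Complex.normSq w' := by
    rw [← Complex.normSq_mul, show (w + E) * w' = k - E * w by linear_combination h]
    simp [hermFst, Complex.normSq_apply]
    ring
  have t2 : hermSnd E (Complex.normSq w) 1 w = Complex.normSq (w + E) := by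
    simp [hermSnd, Complex.normSq_apply]
    ring
  have t3 : hermCorner E k (Complex.normSq w) 1 w = Complex.normSq (w + E) * w' := by
    have : (Complex.normSq (w + E) : ℂ) * w' = (k - E * w) * starRingEnd ℂ (w + E) := by
      rw [← Complex.mul_conj]
      linear_combination starRingEnd ℂ (w + E) * h
    rw [this]
    apply Complex.ext <;>
    · simp [hermCorner, Complex.normSq_apply]
      ring
  rw [sphereInvolution, norm_spherePoint hR.le, a0, b0, w0, s1, s2, s3, t1, t2, t3]
  unfold spherePoint
  congr 1
  · field_simp
    ring
  · rw [← mul_assoc, ← mul_assoc, ← Complex.ofReal_mul, ← Complex.ofReal_mul]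
    congr 2
    field_simp
    ring

/-- These parameters give `w ↦ 1 / w`, which sends `(X, W)` to `(-X, conj W)` on every sphere at
once. -/
theorem sphereInvolution_base (v : Space) : sphereInvolution 0 1 v = turn Real.pi v := by
  conv_rhs => rw [← place_cross v]
  rw [turn_pi_place]
  by_cases hv : v = 0
  · subst hv
    rw [sphereInvolution_zero]
    ext i
    fin_cases i <;> simp [place, cross]
  have hR := (norm_pos_iff.mpr hv).ne'
  simp only [sphereInvolution, hermFst, hermSnd, hermCorner]
  simp only [map_zero, map_one, zero_mul, one_mul, Complex.zero_re, mul_zero, sub_zero, zero_add,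
    add_zero, neg_zero, Complex.ofReal_zero]
  rw [show ‖v‖ + v 0 + (‖v‖ - v 0) = 2 * ‖v‖ by ring]
  congr 1
  · field_simp
    ring
  · rw [div_self (by simpa using hR), Complex.ofReal_one, one_mul]

/-! ### Involutions whose parameters vary with the radius -/

section Isotopy

variable {E k : ℝ → ℂ}

/-- The involution of each sphere whose parameters are taken at `s` times the radius. -/
def radialInvolution (h : ∀ x, E x ^ 2 + k x ≠ 0) (s : ℝ) : Space ≃ Space :=
  Function.Involutive.toPerm (fun v => sphereInvolution (E (s * ‖v‖)) (k (s * ‖v‖)) v) fun v => by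
    simp only [norm_sphereInvolution (h _)]
    exact sphereInvolution_involutive (h _) v

theorem radialInvolution_apply (h : ∀ x, E x ^ 2 + k x ≠ 0) (s : ℝ) (v : Space) :
    radialInvolution h s v = sphereInvolution (E (s * ‖v‖)) (k (s * ‖v‖)) v := rfl

theorem contDiff_turn (θ : ℝ) : ContDiff ℝ ∞ (turn θ) := by
  exact ((contDiff_const.mul (contDiff_coord 0)).sub (contDiff_const.mul (contDiff_coord 2))).place
    (contDiff_mk (contDiff_coord 1)
      ((contDiff_const.mul (contDiff_coord 0)).add (contDiff_const.mul (contDiff_coord 2))))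

section Pointwise

variable {F : Type*} [NormedAddCommGroup F] [NormedSpace ℝ F] {u : F}

theorem ContDiffAt.ofReal {f : F → ℝ} (hf : ContDiffAt ℝ ∞ f u) :
    ContDiffAt ℝ ∞ (fun t => (f t : ℂ)) u := Complex.ofRealCLM.contDiff.contDiffAt.comp u hf

theorem ContDiffAt.conj {f : F → ℂ} (hf : ContDiffAt ℝ ∞ f u) :
    ContDiffAt ℝ ∞ (fun t => starRingEnd ℂ (f t)) u :=
  Complex.conjCLE.contDiff.contDiffAt.comp u hf

theorem ContDiffAt.re {f : F → ℂ} (hf : ContDiffAt ℝ ∞ f u) :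
    ContDiffAt ℝ ∞ (fun t => (f t).re) u := Complex.reCLM.contDiff.contDiffAt.comp u hf

theorem ContDiffAt.normSq {f : F → ℂ} (hf : ContDiffAt ℝ ∞ f u) :
    ContDiffAt ℝ ∞ (fun t => Complex.normSq (f t)) u :=
  (contDiff_id.normSq (E := ℂ)).contDiffAt.comp u hf

variable {e κ W : F → ℂ} {A B : F → ℝ}

theorem ContDiffAt.hermFst (he : ContDiffAt ℝ ∞ e u) (hκ : ContDiffAt ℝ ∞ κ u)
    (hA : ContDiffAt ℝ ∞ A u) (hB : ContDiffAt ℝ ∞ B u) (hW : ContDiffAt ℝ ∞ W u) :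
    ContDiffAt ℝ ∞ (fun t => hermFst (e t) (κ t) (A t) (B t) (W t)) u :=
  ((he.normSq.mul hA).sub (contDiffAt_const.mul ((he.mul hκ.conj).mul hW).re)).add
    (hκ.normSq.mul hB)

theorem ContDiffAt.hermSnd (he : ContDiffAt ℝ ∞ e u)
    (hA : ContDiffAt ℝ ∞ A u) (hB : ContDiffAt ℝ ∞ B u) (hW : ContDiffAt ℝ ∞ W u) :
    ContDiffAt ℝ ∞ (fun t => hermSnd (e t) (A t) (B t) (W t)) u :=
  (hA.add (contDiffAt_const.mul (hW.mul he.conj).re)).add (he.normSq.mul hB)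

theorem ContDiffAt.hermCorner (he : ContDiffAt ℝ ∞ e u) (hκ : ContDiffAt ℝ ∞ κ u)
    (hA : ContDiffAt ℝ ∞ A u) (hB : ContDiffAt ℝ ∞ B u) (hW : ContDiffAt ℝ ∞ W u) :
    ContDiffAt ℝ ∞ (fun t => hermCorner (e t) (κ t) (A t) (B t) (W t)) u :=
  (((he.neg.mul hA.ofReal).sub (he.normSq.ofReal.mul hW)).add (hκ.mul hW.conj)).add
    ((hκ.mul he.conj).mul hB.ofReal)

theorem ContDiffAt.sphereInvolution {V : F → Space} (he : ContDiffAt ℝ ∞ e u)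
    (hκ : ContDiffAt ℝ ∞ κ u) (hV : ContDiffAt ℝ ∞ V u) (hk : e u ^ 2 + κ u ≠ 0) (h0 : V u ≠ 0) :
    ContDiffAt ℝ ∞ (fun t => sphereInvolution (e t) (κ t) (V t)) u := by
  have hN : ContDiffAt ℝ ∞ (fun t => ‖V t‖) u := hV.norm ℝ h0
  have hX : ContDiffAt ℝ ∞ (fun t => V t 0) u := (contDiff_coord 0).contDiffAt.comp u hV
  have hW : ContDiffAt ℝ ∞ (fun t => cross (V t)) u := contDiff_cross.contDiffAt.comp u hV
  have hA := hN.sub hX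
  have hB := hN.add hX
  have h1 := he.hermFst hκ hA hB hW
  have h2 := he.hermSnd hA hB hW
  have h3 := he.hermCorner hκ hA hB hW
  have hT := (herm_trace_pos_of_ne_zero hk h0).ne'
  unfold _root_.sphereInvolution
  refine ContDiffAt.place ?_ (ContDiffAt.mul (ContDiffAt.ofReal ?_) h3)
  · exact (hN.mul (h2.sub h1)).div (h1.add h2) hT
  · exact (contDiffAt_const.mul hN).div (h1.add h2) hT

end Pointwise

/-- The norm fails to be smooth only at the origin, and near it the parameters are constant, so the
map is a rotation there. `Real.smoothTransition` keeps the scaling factor in `[0, 1]` for all times.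
-/
theorem contDiff_radialInvolution (h : ∀ x, E x ^ 2 + k x ≠ 0) (hE : ContDiff ℝ ∞ E)
    (hk : ContDiff ℝ ∞ k) (h0 : ∀ x ≤ 1, E x = 0 ∧ k x = 1) :
    ContDiff ℝ ∞
      (fun u : ℝ × Space => radialInvolution h (Real.smoothTransition u.1) u.2) := by
  rw [contDiff_iff_contDiffAt]
  rintro ⟨s, v⟩
  by_cases hv : v = 0
  · subst hv
    refine ((contDiff_turn Real.pi).comp contDiff_snd).contDiffAt.congr_of_eventuallyEq ?_
    have : ∀ᶠ u : ℝ × Space in nhds (s, 0), ‖u.2‖ < 1 :=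
      (continuous_snd.norm.continuousAt).eventually (gt_mem_nhds (by simp))
    filter_upwards [this] with u hu
    have hle : Real.smoothTransition u.1 * ‖u.2‖ ≤ 1 :=
      mul_le_one₀ (Real.smoothTransition.le_one _) (norm_nonneg _) hu.le
    rw [radialInvolution_apply, (h0 _ hle).1, (h0 _ hle).2, sphereInvolution_base]
    rfl
  · have hs : ContDiffAt ℝ ∞ (fun u : ℝ × Space => u.2) (s, v) := contDiffAt_snd
    have hl : ContDiffAt ℝ ∞ (fun u : ℝ × Space => Real.smoothTransition u.1 * ‖u.2‖) (s, v) :=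
      (contDiff_smoothTransition.contDiffAt.comp (s, v) contDiffAt_fst).mul (hs.norm ℝ hv)
    have he : ContDiffAt ℝ ∞
        (fun u : ℝ × Space => E (Real.smoothTransition u.1 * ‖u.2‖)) (s, v) :=
      hE.contDiffAt.comp (s, v) hl
    have hκ : ContDiffAt ℝ ∞
        (fun u : ℝ × Space => k (Real.smoothTransition u.1 * ‖u.2‖)) (s, v) :=
      hk.contDiffAt.comp (s, v) hl
    simp only [radialInvolution_apply]
    exact he.sphereInvolution hκ hs (h _) hv

/-- Scaling the radius by a factor that shrinks to 0 gives every sphere the parameters at 0, so the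
family joins the involution to a half-turn. -/
theorem isDiffeotopic_radialInvolution (h : ∀ x, E x ^ 2 + k x ≠ 0) (hE : ContDiff ℝ ∞ E)
    (hk : ContDiff ℝ ∞ k) (h0 : ∀ x ≤ 1, E x = 0 ∧ k x = 1) :
    IsDiffeotopic (radialInvolution h 1) := by
  have hJ := contDiff_radialInvolution h hE hk h0
  have hbase : radialInvolution h (Real.smoothTransition 0) = turn Real.pi := by
    ext1 v
    rw [radialInvolution_apply, Real.smoothTransition.zero, zero_mul, (h0 0 zero_le_one).1,
      (h0 0 zero_le_one).2, sphereInvolution_base]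
  have h1 := IsDiffeotopic.of_family
    (G := fun s => radialInvolution h (Real.smoothTransition s)) hJ hJ (hbase ▸ isDiffeotopic_turn)
  simpa only [Real.smoothTransition.one] using h1

end Isotopy

/-! ### The involution of a canonical link -/

/-- The square of the radius of the two ellipses, as a function of the first coordinate. -/
def radiusSq (n : ℕ) (x : ℝ) : ℝ := 1 - (((n : ℝ) / 2 - x) / ((n : ℝ) / 2 + 1)) ^ 2

theorem contDiff_radiusSq (n : ℕ) : ContDiff ℝ ∞ (radiusSq n) :=
  contDiff_const.sub (((contDiff_const.sub contDiff_id).div_const _).pow 2)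

theorem radiusSq_le_one (n : ℕ) (x : ℝ) : radiusSq n x ≤ 1 := by
  unfold radiusSq
  have := sq_nonneg (((n : ℝ) / 2 - x) / ((n : ℝ) / 2 + 1))
  linarith

theorem radiusSq_nonneg {n : ℕ} {x : ℝ} (h0 : 0 ≤ x) (h1 : x ≤ n) : 0 ≤ radiusSq n x := by
  unfold radiusSq
  have hp : (0 : ℝ) < (n : ℝ) / 2 + 1 := by positivity
  have : (((n : ℝ) / 2 - x) / ((n : ℝ) / 2 + 1)) ^ 2 ≤ 1 := by
    rw [sq_le_one_iff_abs_le_one, abs_div, abs_of_pos hp, div_le_one hp, abs_le]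
    constructor <;> linarith
  linarith

theorem radiusSq_axial (n : ℕ) (t : ℝ) : radiusSq n (axial n t) = Real.sin t ^ 2 := by
  have hp : ((n : ℝ) / 2 + 1) ≠ 0 := by positivity
  have : ((n : ℝ) / 2 - axial n t) / ((n : ℝ) / 2 + 1) = Real.cos t := by
    unfold axial
    field_simp
    ring
  rw [radiusSq, this]
  linarith [Real.sin_sq_add_cos_sq t]

/-- The parameter `E` of the involution `w ↦ (k - E w) / (w + E)` exchanging the two upper strands
and the two lower strands over the point `x`. -/
def involE (b : List ℤ) (x : ℝ) : ℂ :=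
  radiusSq b.length x * (unitAt (upperAngle b x) ^ 2 - 1) / 8

/-- The parameter `k` of the same involution. -/
def involK (b : List ℤ) (x : ℝ) : ℂ :=
  (4 - radiusSq b.length x * (1 + unitAt (upperAngle b x) ^ 2) / 2) * unitAt (middleAngle b x)

theorem contDiff_involE (b : List ℤ) : ContDiff ℝ ∞ (involE b) := by
  unfold involE
  simp only [div_eq_mul_inv]
  exact ((contDiff_radiusSq _).ofReal.mul
    (((contDiff_unitAt.comp (contDiff_upperAngle b)).pow 2).sub contDiff_const)).mul contDiff_const

theorem contDiff_involK (b : List ℤ) : ContDiff ℝ ∞ (involK b) := by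
  unfold involK
  simp only [div_eq_mul_inv]
  exact (contDiff_const.sub (((contDiff_radiusSq _).ofReal.mul (contDiff_const.add
    ((contDiff_unitAt.comp (contDiff_upperAngle b)).pow 2))).mul contDiff_const)).mul
      (contDiff_unitAt.comp (contDiff_middleAngle b))

theorem invol_outside {b : List ℤ} (hb : ∀ a ∈ b, Even a) {x : ℝ}
    (hx : x ≤ 0 ∨ (b.length : ℝ) ≤ x) :
    involE b x = 0 ∧ involK b x = ((4 - radiusSq b.length x : ℝ) : ℂ) := by
  have h1 := unitAt_upper hb fun i hi _ => outside_block hx i hi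
  have h2 := unitAt_middle hb fun i hi _ => outside_block hx i hi
  constructor
  · simp [involE, h1]
  · rw [involK, h1, h2]
    push_cast
    ring

/-- Inside the twisted range `|E| ≤ 1/4` and `|k| ≥ 3`, so `E²` cannot cancel `k`. Outside it `E =
0` and `k ≥ 3`; there `radiusSq` may be negative, but only its upper bound matters. -/
theorem invol_nondegenerate {b : List ℤ} (hb : ∀ a ∈ b, Even a) (x : ℝ) :
    involE b x ^ 2 + involK b x ≠ 0 := by
  by_cases hx : x ≤ 0 ∨ (b.length : ℝ) ≤ x
  · rw [(invol_outside hb hx).1, (invol_outside hb hx).2]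
    have := radiusSq_le_one b.length x
    have h : (4 - radiusSq b.length x : ℝ) ≠ 0 := by linarith
    rw [zero_pow two_ne_zero, zero_add]
    exact_mod_cast h
  · push Not at hx
    have r0 := radiusSq_nonneg hx.1.le hx.2.le
    have r1 := radiusSq_le_one b.length x
    have nu : ‖unitAt (upperAngle b x) ^ 2‖ = 1 := by rw [norm_pow, norm_unitAt, one_pow]
    have nm := norm_unitAt (middleAngle b x)
    unfold involE involK
    generalize unitAt (upperAngle b x) ^ 2 = u at *
    generalize unitAt (middleAngle b x) = m at *
    generalize radiusSq b.length x = r at *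
    have nr : ‖(r : ℂ)‖ ≤ 1 := by rw [Complex.norm_real, Real.norm_of_nonneg r0]; exact r1
    have hE : ‖(r * (u - 1) / 8 : ℂ)‖ ≤ 1 / 4 := by
      have h1 : ‖u - 1‖ ≤ 2 := (norm_sub_le _ _).trans (by rw [nu, norm_one]; norm_num)
      have h2 := mul_le_mul nr h1 (norm_nonneg _) zero_le_one
      rw [norm_div, norm_mul, RCLike.norm_ofNat]
      linarith
    have hk : 3 ≤ ‖(4 - r * (1 + u) / 2 : ℂ)‖ := by
      have h1 : ‖1 + u‖ ≤ 2 := (norm_add_le _ _).trans (by rw [nu, norm_one]; norm_num)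
      have h2 := mul_le_mul nr h1 (norm_nonneg _) zero_le_one
      have h3 : ‖(r * (1 + u) / 2 : ℂ)‖ ≤ 1 := by
        rw [norm_div, norm_mul, RCLike.norm_ofNat]
        linarith
      have h4 := norm_sub_norm_le (4 : ℂ) (r * (1 + u) / 2)
      rw [RCLike.norm_ofNat] at h4
      linarith
    intro h0
    have h1 := congrArg norm (eq_neg_of_add_eq_zero_left h0)
    rw [norm_neg, norm_pow, norm_mul, nm, mul_one] at h1
    nlinarith [norm_nonneg (r * (u - 1) / 8 : ℂ)]

/-- Opposite points of a component are exchanged by the involution. -/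
theorem invol_canonicalCurve {b : List ℤ} (hb : ∀ a ∈ b, Even a) (k : Fin 2) (t : ℝ) :
    cross (canonicalCurve b k t) * cross (canonicalCurve b k (-t)) +
      involE b (axial b.length t) *
        (cross (canonicalCurve b k t) + cross (canonicalCurve b k (-t))) =
      involK b (axial b.length t) := by
  have ha : axial b.length (-t) = axial b.length t := by simp [axial]
  have hor := unitAt_middle_or_upper hb (axial b.length t)
  have hout : Real.sin t = 0 → unitAt (middleAngle b (axial b.length t)) = 1 := fun h =>
    unitAt_middle hb fun i hi _ => outside_block (eventually_outside b.length h).self_of_nhds i hi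
  unfold canonicalCurve involE involK upperPoint lowerPoint
  simp only [cross_place, ha, radiusSq_axial, Real.sin_neg]
  generalize unitAt (middleAngle b (axial b.length t)) = m at *
  generalize unitAt (upperAngle b (axial b.length t)) = u at *
  generalize Real.sin t = r at *
  -- The parameters `t` and `-t` lie on opposite strands, so exactly one of the two factors is `m`,
  -- except when `r = 0`, where `m = 1`.
  have hm : ∀ c d : ℂ, (if 0 < r then m else 1) * c * ((if 0 < -r then m else 1) * d) =
      m * (c * d) := by
    intro c d
    rcases lt_trichotomy r 0 with h | h | h
    · rw [if_neg (by linarith), if_pos (by linarith)]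
      ring
    · rw [hout h]
      simp
    · rw [if_pos h, if_neg (by linarith)]
      ring
  have hm' : ∀ c d : ℂ, (if r < 0 then m else 1) * c * ((if -r < 0 then m else 1) * d) =
      m * (c * d) := by
    intro c d
    have := hm d c
    simp only [Left.neg_pos_iff] at this
    simp only [Left.neg_neg_iff]
    rw [mul_comm, this]
    ring
  by_cases hk : k = 0
  · simp only [hk, if_true]
    rw [hm]
    push_cast
    -- If `m = 1`, the pairs are `2 ± r u` and `-2 ± r`, with sums 4 and -4; the two resulting
    -- linear equations determine `E` and `k`. If `u = 1`, then `E = 0` and both pairs have product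
    -- `m (4 - r²)`.
    rcases hor with rfl | rfl
    · simp only [ite_self]
      ring
    · ring
  · simp only [hk, if_false]
    rw [hm']
    push_cast
    rcases hor with rfl | rfl
    · simp only [ite_self]
      ring
    · ring

/-! ### Transport of the parameters to the concentric spheres -/

/-- The parameter `E`, on the sphere of radius `ℓ`. -/
def levelE (b : List ℤ) (ℓ : ℝ) : ℂ := involE b (ℓ - 11)

/-- The parameter `k` on the sphere of radius `ℓ`, made constant near the origin. -/
def levelK (b : List ℤ) (ℓ : ℝ) : ℂ :=
  1 + Real.smoothTransition (ℓ - 2) * (involK b (ℓ - 11) - 1)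

theorem contDiff_levelE (b : List ℤ) : ContDiff ℝ ∞ (levelE b) :=
  (contDiff_involE b).comp (contDiff_id.sub contDiff_const)

theorem contDiff_levelK (b : List ℤ) : ContDiff ℝ ∞ (levelK b) :=
  contDiff_const.add (((contDiff_smoothTransition.comp
    (contDiff_id.sub contDiff_const)).ofReal).mul
      (((contDiff_involK b).comp (contDiff_id.sub contDiff_const)).sub contDiff_const))

theorem levelK_of_three_le (b : List ℤ) {ℓ : ℝ} (h : 3 ≤ ℓ) : levelK b ℓ = involK b (ℓ - 11) := by
  rw [levelK, Real.smoothTransition.one_of_one_le (by linarith)]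
  push_cast
  ring

theorem level_base {b : List ℤ} (hb : ∀ a ∈ b, Even a) (ℓ : ℝ) (h : ℓ ≤ 1) :
    levelE b ℓ = 0 ∧ levelK b ℓ = 1 := by
  refine ⟨(invol_outside hb (Or.inl (by linarith))).1, ?_⟩
  rw [levelK, Real.smoothTransition.zero_of_nonpos (by linarith)]
  simp

/-- Up to radius 3 all twisting is still absent, so `E = 0` and the cutoff interpolates between 1
and a real number at least 3, never reaching 0. -/
theorem level_nondegenerate {b : List ℤ} (hb : ∀ a ∈ b, Even a) (ℓ : ℝ) :
    levelE b ℓ ^ 2 + levelK b ℓ ≠ 0 := by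
  rcases le_total 3 ℓ with h | h
  · rw [levelK_of_three_le b h]
    exact invol_nondegenerate hb _
  · obtain ⟨h1, h2⟩ := invol_outside hb (x := ℓ - 11) (Or.inl (by linarith))
    rw [levelE, levelK, h1, h2]
    have h3 := Real.smoothTransition.nonneg (ℓ - 2)
    have h4 := radiusSq_le_one b.length (ℓ - 11)
    have h5 : (1 + Real.smoothTransition (ℓ - 2) * (4 - radiusSq b.length (ℓ - 11) - 1) : ℝ) ≠ 0 := by
      have := mul_nonneg h3 (show 0 ≤ 4 - radiusSq b.length (ℓ - 11) - 1 by linarith)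
      positivity
    rw [zero_pow two_ne_zero, zero_add]
    exact_mod_cast h5

theorem norm_cross_canonicalCurve_le (b : List ℤ) (k : Fin 2) (t : ℝ) :
    ‖cross (canonicalCurve b k t)‖ ≤ 3 := by
  have hs : ‖(Real.sin t : ℂ)‖ ≤ 1 := by
    rw [Complex.norm_real]
    exact Real.abs_sin_le_one t
  have hite : ∀ (P : Prop) [Decidable P],
      ‖(if P then unitAt (middleAngle b (axial b.length t)) else 1 : ℂ)‖ = 1 := by
    intro P _
    split_ifs
    · exact norm_unitAt _
    · exact norm_one
  unfold canonicalCurve upperPoint lowerPoint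
  rw [cross_place]
  by_cases hk : k = 0
  · rw [if_pos hk, norm_mul, hite, one_mul]
    refine (norm_sub_le _ _).trans ?_
    rw [norm_mul, norm_unitAt, RCLike.norm_ofNat]
    linarith
  · rw [if_neg hk, norm_mul, hite, one_mul]
    refine (norm_sub_le _ _).trans ?_
    rw [norm_neg, RCLike.norm_ofNat]
    linarith

theorem neg_one_le_axial (n : ℕ) (t : ℝ) : -1 ≤ axial n t := by
  unfold axial
  have := mul_le_mul_of_nonneg_left (Real.cos_le_one t) (show (0 : ℝ) ≤ (n : ℝ) / 2 + 1 by positivity)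
  linarith

theorem spherify_canonicalCurve (b : List ℤ) (k : Fin 2) (t : ℝ) :
    spherify (canonicalCurve b k t) =
      spherePoint (axial b.length t + 11) (cross (canonicalCurve b k t)) := by
  rw [← spherify_place (neg_one_le_axial _ t) (norm_cross_canonicalCurve_le b k t)]
  simp [canonicalCurve]

/-- An ambient isotopy reverses both components of a canonical link. -/
theorem exists_diffeotopic_reversing {b : List ℤ} (hb : ∀ a ∈ b, Even a) :
    ∃ e : Space ≃ Space, IsDiffeotopic e ∧
      ∀ k t, e (canonicalCurve b k t) = canonicalCurve b k (-t) := by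
  have hJ := isDiffeotopic_radialInvolution (level_nondegenerate hb) (contDiff_levelE b)
    (contDiff_levelK b) (level_base hb)
  refine ⟨(spherify.trans (radialInvolution (level_nondegenerate hb) 1)).trans spherify.symm,
    hJ.conj isDiffeo_spherify, fun k t => ?_⟩
  have hx := neg_one_le_axial b.length t
  have ha : axial b.length (-t) = axial b.length t := by simp [axial]
  have key : radialInvolution (level_nondegenerate hb) 1 (spherify (canonicalCurve b k t)) =
      spherify (canonicalCurve b k (-t)) := by
    rw [spherify_canonicalCurve, spherify_canonicalCurve, ha, radialInvolution_apply,
      norm_spherePoint (by linarith), one_mul]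
    refine sphereInvolution_spherePoint (by linarith) (level_nondegenerate hb _) ?_
    -- The curve lies on spheres of radius at least 10, beyond the cutoff in `levelK`.
    rw [levelE, levelK_of_three_le b (by linarith), add_sub_cancel_right]
    exact invol_canonicalCurve hb k t
  rw [Equiv.trans_apply, Equiv.trans_apply, key, Equiv.symm_apply_apply]

/-- Reversal of the word does not change the oriented link. -/
theorem canonicalLink_isotopic_reverse {b : List ℤ} (hb : ∀ a ∈ b, Even a) (hn : Odd b.length)
    {b' : List ℤ} (hb' : ∀ a ∈ b', Even a) (h : b' = b.reverse) :
    (canonicalLink b hb).Isotopic (canonicalLink b' hb') := by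
  subst h
  obtain ⟨e, he, hrev⟩ := exists_diffeotopic_reversing hb
  -- The two reversals `t ↦ -t` and `t ↦ π - t` compose to the translation by `π`, which preserves
  -- orientation.
  have key : ∀ k t, (e.trans (halfTurn ((b.length : ℝ) / 2))) (canonicalCurve b k t) =
      canonicalCurve b.reverse k (t + Real.pi) := fun k t => by
    rw [Equiv.trans_apply, hrev, halfTurn_canonicalCurve hb hn, sub_neg_eq_add, add_comm Real.pi t]
  exact OrientedLink.isotopic_of_diffeotopic (he.trans (isDiffeotopic_halfTurn _))
    (Equiv.refl _) Real.pi key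

end

/-- `rationalLink` uses a chosen expansion, so uniqueness is needed to identify the one chosen for
`pbar / q` with the reversed list. -/
theorem lemma4 (p pbar q : ℤ) (hq : Even q)
    (hco : IsCoprime p q) (hlt : |p| < |q|)
    (hcobar : IsCoprime pbar q) (hltbar : |pbar| < |q|)
    (h : p * pbar ≡ 1 [ZMOD 2 * q]) :
    (rationalLink p q hco hq hlt).Isotopic (rationalLink pbar q hcobar hq hltbar) := by
  have hb := (exists_canonicalExpansion hco hq hlt).choose_spec
  have hb' := (exists_canonicalExpansion hcobar hq hltbar).choose_spec
  exact canonicalLink_isotopic_reverse hb.even hb.odd_length hb'.even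
    (canonicalExpansion_unique hb' (hb.reverse hco hltbar h))
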